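/- Let $X_1,\dots,X_n$ be independent random variables with values in a measurable space $\mathcal X$, let $F:\mathcal X^n\to\mathbb R$ be measurable and $Z=F(X_1,\dots,X_n)$. For each $i$ let $F_i:\mathcal X^{n-1}\to\mathbb R$ be measurable and $Z_i=F_i(X_1,\dots,X_{i-1},X_{i+1},\dots,X_n)$. Put $V=\sum_{i=1}^n (Z-Z_i)^2$, $\|Y\|_q=(\mathbb E|Y|^q)^{1/q}\in[0,\infty]$, $x_+=\max(x,0)$, $x_-=\max(-x,0)$, and $$\kappa=\frac{\sqrt e}{2(\sqrt e-1)}.$$ Let $C_2$ be the unique zero on $(0,\infty)$ of $x\mapsto e^{-1/2}+\frac{1}{2x}e^{1/\sqrt x}-1$. Assume that, almost surely, $Z\ge 0$, $Z_i\le Z$ for all $1\le i\le n$, and $V\le WZ$ for a random variable $W\ge 0$. Then for all real $q\ge 2$ and all $\theta\in(0,1]$, $$\|Z\|_q\le(1+\theta)\,\mathbb E[Z]+\frac{\kappa}{2}\Bigl(1+\frac1\theta\Bigr)q\,\|W\|_q ,$$ and for all real $q\ge 2$, $$\|(Z-\mathbb E[Z])_+\|_q\le\sqrt{2\kappa q\,\|W\|_q\,\mathbb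 E[Z]}+\kappa q\,\|W\|_q .$$ Moreover $C_2<2.42$, and if $M\ge 0$ is a random variable such that, almost surely, $0\le Z-Z_i\le M$ for every $1\le i\le n$, then for all real $q\ge 2$, $$\|(Z-\mathbb E[Z])_-\|_q\le\sqrt{C_2\,q\,\Bigl(\|W\|_q\,\bigl(2\,\mathbb E[Z]+2q\,\|W\|_q\bigr)\ \vee\ q\,\|M\|_q^2\Bigr)} .$$ All expectations and norms are taken in $[0,\infty]$, with $0\cdot\infty=0$; if $\mathbb E[Z]=\infty$, then $(Z-\mathbb E[Z])_+=0$ and $(Z-\mathbb E[Z])_-=\infty$. -/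

import Mathlib

open MeasureTheory ProbabilityTheory
open scoped ENNReal

noncomputable section

/-- The constant `κ = √e / (2 (√e - 1))`. -/
def kappaConst : ℝ :=
  Real.sqrt (Real.exp 1) / (2 * (Real.sqrt (Real.exp 1) - 1))

/-- The function `x ↦ e^{-1/2} + (1 / (2 x)) e^{1/√x} - 1`, whose zero on `(0, ∞)` is `C₂`. -/
def cTwoFun (x : ℝ) : ℝ :=
  Real.exp (-(1 / 2)) + 1 / (2 * x) * Real.exp (1 / Real.sqrt x) - 1

theorem cTwoFun_strictAntiOn : StrictAntiOn cTwoFun (Set.Ioi 0) := by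
  intro x hx y hy hxy
  have hx' : (0 : ℝ) < x := hx
  have hy' : (0 : ℝ) < y := hy
  have h1 : 1 / (2 * y) < 1 / (2 * x) :=
    one_div_lt_one_div_of_lt (by positivity) (by linarith)
  have h2 : 1 / Real.sqrt y ≤ 1 / Real.sqrt x :=
    one_div_le_one_div_of_le (Real.sqrt_pos.2 hx') (Real.sqrt_le_sqrt hxy.le)
  have h3 := Real.exp_le_exp.2 h2
  have h4 : 1 / (2 * y) * Real.exp (1 / Real.sqrt y)
      < 1 / (2 * x) * Real.exp (1 / Real.sqrt x) :=
    mul_lt_mul h1 h3 (Real.exp_pos _) (by positivity)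
  unfold cTwoFun
  linarith

theorem cTwo_existsUnique : ∃! x : ℝ, 0 < x ∧ cTwoFun x = 0 := by
  have hcont : ContinuousOn cTwoFun (Set.Icc 1 100) := by
    unfold cTwoFun
    refine ((continuousOn_const.add (ContinuousOn.mul ?_ ?_)).sub continuousOn_const)
    · refine continuousOn_const.div (by fun_prop) ?_
      intro x hx
      have := hx.1
      positivity
    · refine Real.continuous_exp.comp_continuousOn (continuousOn_const.div ?_ ?_)
      · exact Real.continuous_sqrt.continuousOn
      · intro x hx
        exact (Real.sqrt_pos.2 (lt_of_lt_of_le one_pos hx.1)).ne'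
  have h1 : 0 ≤ cTwoFun 1 := by
    unfold cTwoFun
    have ha := Real.exp_pos (-(1 / 2))
    have hb := Real.add_one_le_exp (1 : ℝ)
    simp only [Real.sqrt_one, div_one, mul_one]
    linarith
  have h2 : cTwoFun 100 ≤ 0 := by
    unfold cTwoFun
    have hs : Real.sqrt 100 = 10 := by
      rw [show (100 : ℝ) = 10 ^ 2 by norm_num]
      exact Real.sqrt_sq (by norm_num)
    have ha : Real.exp (-(1 / 2)) ≤ 2 / 3 := by
      have := Real.add_one_le_exp (1 / 2 : ℝ)
      rw [Real.exp_neg, inv_le_comm₀ (Real.exp_pos _) (by norm_num)]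
      linarith
    have hb : Real.exp (1 / 10) ≤ 3 :=
      (Real.exp_le_exp.2 (by norm_num)).trans Real.exp_one_lt_three.le
    rw [hs]
    linarith
  obtain ⟨c, hc, hc0⟩ := intermediate_value_Icc' (by norm_num) hcont ⟨h2, h1⟩
  have hcpos : 0 < c := lt_of_lt_of_le one_pos hc.1
  exact ⟨c, ⟨hcpos, hc0⟩, fun y hy =>
    cTwoFun_strictAntiOn.injOn hy.1 hcpos (hy.2.trans hc0.symm)⟩

/-- The constant `C₂`: the unique positive zero of `cTwoFun`. -/
def cTwo : ℝ := cTwo_existsUnique.choose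

variable {Ω 𝒳 : Type*} {n : ℕ}

/-- `Z = F(X₁, …, Xₙ)`. -/
def varZ (F : (Fin n → 𝒳) → ℝ) (X : Fin n → Ω → 𝒳) (ω : Ω) : ℝ :=
  F fun j => X j ω

/-- `Zᵢ = Fᵢ(X₁, …, Xᵢ₋₁, Xᵢ₊₁, …, Xₙ)`: a function of all the coordinates except the `i`-th. -/
def varZi (G : (i : Fin n) → ({j : Fin n // j ≠ i} → 𝒳) → ℝ) (X : Fin n → Ω → 𝒳)
    (i : Fin n) (ω : Ω) : ℝ :=
  G i fun j => X j.1 ω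

/-- `V = ∑ᵢ (Z - Zᵢ)²`. -/
def varV (F : (Fin n → 𝒳) → ℝ) (G : (i : Fin n) → ({j : Fin n // j ≠ i} → 𝒳) → ℝ)
    (X : Fin n → Ω → 𝒳) (ω : Ω) : ℝ :=
  ∑ i, (varZ F X ω - varZi G X i ω) ^ 2

/-- The expectation `E[Y] ∈ [0, ∞]` of an (almost surely) nonnegative random variable. -/
def extMean [MeasurableSpace Ω] (μ : Measure Ω) (Y : Ω → ℝ) : ℝ≥0∞ :=
  ∫⁻ ω, ENNReal.ofReal (Y ω) ∂μ

/-- `(Y - E[Y])₊` for an (almost surely) nonnegative random variable `Y`; the subtraction of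
`[0, ∞]` is truncated at `0`, so it is the positive part of the difference. -/
def devPos [MeasurableSpace Ω] (μ : Measure Ω) (Y : Ω → ℝ) (ω : Ω) : ℝ≥0∞ :=
  ENNReal.ofReal (Y ω) - extMean μ Y

/-- `(Y - E[Y])₋` for an (almost surely) nonnegative random variable `Y`. -/
def devNeg [MeasurableSpace Ω] (μ : Measure Ω) (Y : Ω → ℝ) (ω : Ω) : ℝ≥0∞ :=
  extMean μ Y - ENNReal.ofReal (Y ω)

end

/-! The engine is the entropy method for power functions. For `1 < p ≤ 2` the Bregman divergence `D`
of `t ↦ t ^ p` is jointly convex, so the entropy `E[H^p] - (E H)^p` of a bounded nonnegative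
function of independent variables is at most `∑ᵢ E D(H, Kᵢ)`, for any bounded nonnegative `Kᵢ` not
depending on the `i`-th variable (`entropy_iIndepFun_le`).

Take `Y = φ(Z)` with `φ` 1-Lipschitz, `p = q / (q - 1)`, `H = Y^(q-1)` and `Kᵢ = φ(Zᵢ)^(q-1)`. The
left side becomes `‖Y‖_q^q - ‖Y‖_(q-1)^q`, and `D(x^(q-1), y^(q-1)) ≤ (q/2) max(x,y)^(q-2) (x-y)²`
(`bregmanPow_powDiff_le`). If `φ(Zᵢ) ≤ Y + M`, then Hölder and Minkowski give a recurrence from `q -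
1` to `q` involving only `v ≥ ‖V‖_(q/2)` and `‖M‖_q ≤ s √(v/q)`. It is solved by `‖Y‖_q² ≤ c q v` as
soon as `e^(-1/2) + e^(s/√c)/(2c) ≤ 1` (`moment_recurrence`); the Efron–Stein inequality starts the
induction.

For `Y = (Z - E Z)₊` one has `φ(Zᵢ) ≤ φ(Z)`, so `s = 0` and `c = κ`; for `Y = (Z - E Z)₋` one takes
`s = 1` and `c = C₂`. Since `V ≤ W Z`, Cauchy–Schwarz gives `‖V‖_(q/2) ≤ ‖W‖_q ‖Z‖_q`. Combined with
`‖Z‖_q ≤ E Z + ‖(Z - E Z)₊‖_q`, this is a quadratic inequality, which yields both upper bounds; the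
bound on `‖Z‖_q` with `θ = 1` and `κ ≤ 2` then yields the lower tail.

All this is done for bounded `Z` and `Zᵢ`. In general both are truncated to `[0, N]`, which
preserves `V ≤ W Z` with the same `W` (`sum_truncate_sub_sq_le`), and Fatou's lemma removes the
truncation. -/

/-! ### Joint convexity and size of the Bregman divergence of a power. -/

/-- The Bregman divergence of `t ↦ t ^ p`. -/
noncomputable def bregmanPow (p y u : ℝ) : ℝ := y ^ p - u ^ p - p * u ^ (p - 1) * (y - u)

theorem continuous_bregmanPow {p : ℝ} (hp : 1 < p) :
    Continuous fun z : ℝ × ℝ => bregmanPow p z.1 z.2 := by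
  have h0 : (0 : ℝ) ≤ p := by linarith
  have h1 : (0 : ℝ) ≤ p - 1 := by linarith
  unfold bregmanPow
  exact ((continuous_fst.rpow_const fun _ => Or.inr h0).sub
    (continuous_snd.rpow_const fun _ => Or.inr h0)).sub
    ((continuous_const.mul (continuous_snd.rpow_const fun _ => Or.inr h1)).mul
      (continuous_fst.sub continuous_snd))

/-- The Hessian of `bregmanPow p` is positive semidefinite on the open quadrant. -/
theorem bregmanPow_hessian_nonneg {p y u h k : ℝ} (hp1 : 1 < p) (hp2 : p ≤ 2) (hy : 0 < y)
    (hu : 0 < u) :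
    0 ≤ y ^ (p - 2) * h ^ 2 - 2 * u ^ (p - 2) * h * k
      + u ^ (p - 3) * ((p - 1) * u + (2 - p) * y) * k ^ 2 := by
  have hA : 0 < y ^ (p - 2) := Real.rpow_pos_of_pos hy _
  have hB : 0 < u ^ (p - 2) := Real.rpow_pos_of_pos hu _
  have hE : 0 < u ^ (p - 3) := Real.rpow_pos_of_pos hu _
  -- Weighted AM-GM is exactly nonnegativity of the determinant; the weight `2 - p` is where `p ≤ 2`
  -- is needed.
  have amgm : u ^ (p - 1) * y ^ (2 - p) ≤ (p - 1) * u + (2 - p) * y :=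
    Real.geom_mean_le_arith_mean2_weighted (by linarith) (by linarith) hu.le hy.le (by ring)
  have key : (u ^ (p - 2)) ^ 2
      ≤ y ^ (p - 2) * (u ^ (p - 3) * ((p - 1) * u + (2 - p) * y)) := by
    have h1 : (u ^ (p - 2)) ^ 2 = u ^ (p - 3) * u ^ (p - 1) := by
      rw [← Real.rpow_add hu, pow_two, ← Real.rpow_add hu]
      ring_nf
    have h2 : y ^ (p - 2) * y ^ (2 - p) = 1 := by
      rw [← Real.rpow_add hy, show p - 2 + (2 - p) = 0 by ring, Real.rpow_zero]
    calc (u ^ (p - 2)) ^ 2 = y ^ (p - 2) * (u ^ (p - 3) * (u ^ (p - 1) * y ^ (2 - p))) := by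
          rw [h1]; linear_combination (-(u ^ (p - 3) * u ^ (p - 1))) * h2
      _ ≤ _ := by gcongr
  set A := y ^ (p - 2)
  set B := u ^ (p - 2)
  set C := u ^ (p - 3) * ((p - 1) * u + (2 - p) * y)
  have h3 : 0 ≤ A * (A * h ^ 2 - 2 * B * h * k + C * k ^ 2) := by
    nlinarith [sq_nonneg (A * h - B * k), mul_nonneg (sub_nonneg.2 key) (sq_nonneg k)]
  exact nonneg_of_mul_nonneg_right h3 hA

/-- Along a segment the second derivative is `p (p - 1)` times the quadratic form above. Endpoints
stay in the open quadrant because negative powers of `y` and `u` occur. -/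
theorem convexOn_bregmanPow_segment {p y u h k : ℝ} (hp1 : 1 < p) (hp2 : p ≤ 2)
    (hy : 0 < y) (hu : 0 < u) (hyh : 0 < y + h) (huk : 0 < u + k) :
    ConvexOn ℝ (Set.Icc (0 : ℝ) 1) fun t => bregmanPow p (y + t * h) (u + t * k) := by
  have pos : ∀ {a b t : ℝ}, 0 < a → 0 < a + b → t ∈ Set.Ioo (0 : ℝ) 1 → 0 < a + t * b := by
    intro a b t ha hab ht
    nlinarith [mul_pos ht.1 hab, mul_pos (sub_pos.2 ht.2) ha]
  refine convexOn_of_hasDerivWithinAt2_nonneg (convex_Icc 0 1)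
    (f' := fun t => p * h * (y + t * h) ^ (p - 1) + p * (p - 1) * k * (u + t * k) ^ (p - 1)
      - p * ((p - 1) * k * (u + t * k) ^ (p - 2) * (y + t * h) + (u + t * k) ^ (p - 1) * h))
    (f'' := fun t => p * (p - 1) * ((y + t * h) ^ (p - 2) * h ^ 2
      - 2 * (u + t * k) ^ (p - 2) * h * k
      + (u + t * k) ^ (p - 3) * ((p - 1) * (u + t * k) + (2 - p) * (y + t * h)) * k ^ 2))
    ?_ ?_ ?_ ?_
  · refine Continuous.continuousOn ?_
    exact (continuous_bregmanPow hp1).comp (f := fun t : ℝ => (y + t * h, u + t * k))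
      (by fun_prop)
  all_goals rw [interior_Icc]; intro t ht
  all_goals have hY := pos hy hyh ht
  all_goals have hU := pos hu huk ht
  all_goals have dy : HasDerivAt (fun t : ℝ => y + t * h) h t := by
              simpa using ((hasDerivAt_id t).mul_const h).const_add y
  all_goals have du : HasDerivAt (fun t : ℝ => u + t * k) k t := by
              simpa using ((hasDerivAt_id t).mul_const k).const_add u
  all_goals have e1 : (u + t * k) ^ (p - 1) = (u + t * k) ^ (p - 2) * (u + t * k) := by
              rw [← Real.rpow_add_one hU.ne']; ring_nf
  · refine HasDerivAt.hasDerivWithinAt ?_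
    have := ((dy.rpow_const (p := p) (Or.inl hY.ne')).sub
      (du.rpow_const (p := p) (Or.inl hU.ne'))).sub
      (((du.rpow_const (p := p - 1) (Or.inl hU.ne')).const_mul p).mul (dy.sub du))
    refine this.congr_deriv ?_
    simp only [Pi.sub_apply]
    rw [show p - 1 - 1 = p - 2 by ring, e1]
    ring
  · refine HasDerivAt.hasDerivWithinAt ?_
    have e2 : (u + t * k) ^ (p - 2) = (u + t * k) ^ (p - 3) * (u + t * k) := by
      rw [← Real.rpow_add_one hU.ne']; ring_nf
    have := ((((dy.rpow_const (p := p - 1) (Or.inl hY.ne')).const_mul (p * h)).add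
      ((du.rpow_const (p := p - 1) (Or.inl hU.ne')).const_mul (p * (p - 1) * k))).sub
      (((((du.rpow_const (p := p - 2) (Or.inl hU.ne')).const_mul ((p - 1) * k)).mul dy).add
        ((du.rpow_const (p := p - 1) (Or.inl hU.ne')).mul_const h)).const_mul p))
    refine this.congr_deriv ?_
    rw [show p - 1 - 1 = p - 2 by ring, show p - 2 - 1 = p - 3 by ring, e2]
    ring
  · have := bregmanPow_hessian_nonneg (h := h) (k := k) hp1 hp2 hY hU
    have hp0 : 0 ≤ p * (p - 1) := by nlinarith
    exact mul_nonneg hp0 this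

theorem convexOn_bregmanPow {p : ℝ} (hp1 : 1 < p) (hp2 : p ≤ 2) :
    ConvexOn ℝ (Set.Ici (0 : ℝ) ×ˢ Set.Ici (0 : ℝ)) fun z : ℝ × ℝ => bregmanPow p z.1 z.2 := by
  have hc := continuous_bregmanPow hp1
  refine ⟨(convex_Ici 0).prod (convex_Ici 0), ?_⟩
  rintro ⟨y, u⟩ ⟨hy, hu⟩ ⟨y', u'⟩ ⟨hy', hu'⟩ a b ha hb hab
  have hy : 0 ≤ y := hy
  have hu : 0 ≤ u := hu
  have hy' : 0 ≤ y' := hy'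
  have hu' : 0 ≤ u' := hu'
  obtain rfl : a = 1 - b := by linarith
  -- The closed quadrant is reached by shifting both points by `(ε, ε)` and letting `ε → 0`.
  have hpos : ∀ ε : ℝ, 0 < ε →
      bregmanPow p (((1 - b) * y + b * y') + ε) (((1 - b) * u + b * u') + ε)
      ≤ (1 - b) * bregmanPow p (y + ε) (u + ε) + b * bregmanPow p (y' + ε) (u' + ε) := by
    intro ε hε
    have h := (convexOn_bregmanPow_segment (y := y + ε) (u := u + ε) (h := y' - y)
      (k := u' - u) hp1 hp2 (by linarith) (by linarith) (by linarith) (by linarith)).2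
      (Set.left_mem_Icc.2 zero_le_one) (Set.right_mem_Icc.2 zero_le_one) ha hb hab
    simp only [smul_eq_mul, mul_zero, mul_one, zero_mul, add_zero, zero_add, one_mul] at h
    rwa [show y + ε + b * (y' - y) = (1 - b) * y + b * y' + ε by ring,
      show u + ε + b * (u' - u) = (1 - b) * u + b * u' + ε by ring,
      show y + ε + (y' - y) = y' + ε by ring, show u + ε + (u' - u) = u' + ε by ring] at h
  have lim : ∀ s t : ℝ, Filter.Tendsto (fun ε : ℝ => bregmanPow p (s + ε) (t + ε))
      (nhdsWithin 0 (Set.Ioi 0)) (nhds (bregmanPow p s t)) := by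
    intro s t
    have h : Continuous fun ε : ℝ => bregmanPow p (s + ε) (t + ε) :=
      hc.comp (f := fun ε : ℝ => (s + ε, t + ε)) (by fun_prop)
    have h' := h.tendsto 0
    simp only [add_zero] at h'
    exact h'.mono_left nhdsWithin_le_nhds
  simp only [Prod.smul_mk, Prod.mk_add_mk, smul_eq_mul]
  refine le_of_tendsto_of_tendsto (lim _ _)
    (((lim y u).const_mul (1 - b)).add ((lim y' u').const_mul b)) ?_
  filter_upwards [self_mem_nhdsWithin] with ε hε using hpos ε hε

/-- With `z = max x y` frozen, the difference of the two sides as a function of `t` in place of `x`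
vanishes at `t = y` and has derivative `q (z^(q-2) - t^(q-2)) (t - y)`, which for `0 ≤ t ≤ z` has
the sign of `t - y`. -/
theorem bregmanPow_powDiff_le {q x y : ℝ} (hq : 2 ≤ q) (hx : 0 ≤ x) (hy : 0 ≤ y) :
    bregmanPow (q / (q - 1)) (x ^ (q - 1)) (y ^ (q - 1))
      ≤ q / 2 * (max x y ^ (q - 2) * (x - y) ^ 2) := by
  have hq1 : q - 1 ≠ 0 := by linarith
  have e1 : ∀ z : ℝ, 0 ≤ z → (z ^ (q - 1)) ^ (q / (q - 1)) = z ^ q := by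
    intro z hz
    rw [← Real.rpow_mul hz]
    congr 1
    field_simp
  have e2 : (y ^ (q - 1)) ^ (q / (q - 1) - 1) = y := by
    rw [← Real.rpow_mul hy]
    have : (q - 1) * (q / (q - 1) - 1) = 1 := by field_simp; ring
    rw [this, Real.rpow_one]
  unfold bregmanPow
  rw [e1 x hx, e1 y hy, e2]
  set z := max x y
  have hz : 0 ≤ z := le_max_of_le_left hx
  let g : ℝ → ℝ := fun t => q / 2 * (z ^ (q - 2) * (t - y) ^ 2)
    - (t ^ q - y ^ q - q / (q - 1) * y * (t ^ (q - 1) - y ^ (q - 1)))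
  have hg : ∀ t, 0 ≤ t → HasDerivAt g (q * ((z ^ (q - 2) - t ^ (q - 2)) * (t - y))) t := by
    intro t ht
    have d1 : HasDerivAt (fun t : ℝ => t ^ q) (q * t ^ (q - 1)) t :=
      Real.hasDerivAt_rpow_const (Or.inr (by linarith))
    have d2 : HasDerivAt (fun t : ℝ => t ^ (q - 1)) ((q - 1) * t ^ (q - 1 - 1)) t :=
      Real.hasDerivAt_rpow_const (Or.inr (by linarith))
    have d3 : HasDerivAt (fun t : ℝ => (t - y) ^ 2) (2 * (t - y)) t := by
      exact (((hasDerivAt_id t).sub_const y).pow 2).congr_deriv (by simp)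
    have := ((d3.const_mul (z ^ (q - 2))).const_mul (q / 2)).sub
      ((d1.sub_const (y ^ q)).sub ((d2.sub_const (y ^ (q - 1))).const_mul (q / (q - 1) * y)))
    refine this.congr_deriv ?_
    have e3 : t ^ (q - 1) = t ^ (q - 2) * t := by
      have h := Real.rpow_add_of_nonneg ht (y := q - 2) (z := 1) (by linarith) zero_le_one
      rw [Real.rpow_one, show q - 2 + 1 = q - 1 by ring] at h
      exact h
    rw [e3, show q - 1 - 1 = q - 2 by ring]
    field_simp
  have hgy : g y = 0 := by simp [g]
  suffices h : 0 ≤ g x by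
    simp only [g] at h
    linarith
  have hpow : ∀ t, 0 ≤ t → t ≤ z → 0 ≤ z ^ (q - 2) - t ^ (q - 2) := fun t ht htz =>
    sub_nonneg.2 (Real.rpow_le_rpow ht htz (by linarith))
  rcases le_total y x with hxy | hxy
  · have hmono : MonotoneOn g (Set.Icc y x) := by
      refine monotoneOn_of_hasDerivWithinAt_nonneg (convex_Icc y x)
        (fun t ht => (hg t (hy.trans ht.1)).continuousAt.continuousWithinAt)
        (fun t ht => (hg t (hy.trans (interior_subset ht).1)).hasDerivWithinAt) ?_
      intro t ht
      obtain ⟨h1, h2⟩ := interior_subset ht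
      have := hpow t (hy.trans h1) (h2.trans (le_max_left _ _))
      exact mul_nonneg (by linarith) (mul_nonneg this (by linarith))
    rw [← hgy]
    exact hmono (Set.left_mem_Icc.2 hxy) (Set.right_mem_Icc.2 hxy) hxy
  · have hanti : AntitoneOn g (Set.Icc x y) := by
      refine antitoneOn_of_hasDerivWithinAt_nonpos (convex_Icc x y)
        (fun t ht => (hg t (hx.trans ht.1)).continuousAt.continuousWithinAt)
        (fun t ht => (hg t (hx.trans (interior_subset ht).1)).hasDerivWithinAt) ?_
      intro t ht
      obtain ⟨h1, h2⟩ := interior_subset ht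
      have := hpow t (hx.trans h1) (h2.trans (le_max_right _ _))
      exact mul_nonpos_of_nonneg_of_nonpos (by linarith)
        (mul_nonpos_of_nonneg_of_nonpos this (by linarith))
    rw [← hgy]
    exact hanti (Set.left_mem_Icc.2 hxy) (Set.right_mem_Icc.2 hxy) hxy

/-! ### Solving the recurrence on moments. -/

theorem one_sub_inv_rpow_le_exp {q : ℝ} (hq : 2 ≤ q) :
    (1 - 1 / q) ^ (q / 2) ≤ Real.exp (-(1 / 2)) := by
  have h0 : 0 ≤ 1 - 1 / q := by
    have : 1 / q ≤ 1 / 2 := one_div_le_one_div_of_le (by norm_num) hq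
    linarith
  have h1 : 1 - 1 / q ≤ Real.exp (-(1 / q)) := by
    have := Real.add_one_le_exp (-(1 / q))
    linarith
  calc (1 - 1 / q) ^ (q / 2) ≤ Real.exp (-(1 / q)) ^ (q / 2) :=
        Real.rpow_le_rpow h0 h1 (by linarith)
    _ = Real.exp (-(1 / 2)) := by
        rw [← Real.exp_mul]
        congr 1
        field_simp

theorem one_add_div_rpow_le_exp {q r : ℝ} (hq : 2 ≤ q) (hr : 0 ≤ r) :
    (1 + r / q) ^ (q - 2) ≤ Real.exp r := by
  have h1 : 1 + r / q ≤ Real.exp (r / q) := by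
    have := Real.add_one_le_exp (r / q)
    linarith
  have h2 : 0 ≤ r / q := div_nonneg hr (by linarith)
  calc (1 + r / q) ^ (q - 2) ≤ Real.exp (r / q) ^ (q - 2) :=
        Real.rpow_le_rpow (by linarith) h1 (by linarith)
    _ = Real.exp (r / q * (q - 2)) := by rw [← Real.exp_mul]
    _ ≤ Real.exp r := by
        refine Real.exp_le_exp.2 ?_
        have : r / q * q = r := by field_simp
        nlinarith

/-- One step of the recurrence on the moments. -/
theorem sq_le_of_moment_recurrence {a b v c s q : ℝ} (hq : 2 ≤ q) (hv : 0 ≤ v) (ha : 0 ≤ a)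
    (hb : 0 ≤ b) (hs : 0 ≤ s) (hc : 1 ≤ c)
    (hconst : Real.exp (-(1 / 2)) + 1 / (2 * c) * Real.exp (s / Real.sqrt c) ≤ 1)
    (hb2 : b ^ 2 ≤ c * (q - 1) * v)
    (hrec : a ^ q ≤ b ^ q + q / 2 * (v * (a + s * Real.sqrt (v / q)) ^ (q - 2))) :
    a ^ 2 ≤ c * q * v := by
  -- If `a² > K = c q v`, both terms on the right of the recurrence are at most multiples of
  -- `a^(q-2) K` whose coefficients sum to at most 1, so `a^q ≤ a^(q-2) K`, a contradiction.
  by_contra! hlt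
  have hc0 : 0 < c := by linarith
  have hq0 : 0 < q := by linarith
  set K := c * q * v with hK
  have hK0 : 0 ≤ K := by positivity
  have ha0 : 0 < a := by
    rcases ha.lt_or_eq with h | h
    · exact h
    · rw [← h] at hlt; norm_num at hlt; linarith
  have hsplit : a ^ q = a ^ (q - 2) * a ^ 2 := by
    rw [← Real.rpow_natCast a 2, ← Real.rpow_add ha0]
    norm_num
  have hP : 0 < a ^ (q - 2) := Real.rpow_pos_of_pos ha0 _
  have h1 : b ^ q ≤ a ^ (q - 2) * K * Real.exp (-(1 / 2)) := by
    have e1 : b ^ q = (b ^ 2) ^ (q / 2) := by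
      rw [← Real.rpow_natCast b 2, ← Real.rpow_mul hb]
      congr 1
      push_cast
      ring
    have e2 : c * (q - 1) * v = K * (1 - 1 / q) := by
      rw [hK]
      field_simp
    have hq' : 0 ≤ 1 - 1 / q := by
      have : 1 / q ≤ 1 / 2 := one_div_le_one_div_of_le (by norm_num) hq
      linarith
    have e3 : K ^ (q / 2) ≤ a ^ (q - 2) * K := by
      have h := Real.rpow_add_of_nonneg hK0 (y := q / 2 - 1) (z := 1) (by linarith) zero_le_one
      rw [Real.rpow_one, sub_add_cancel] at h
      rw [h]
      refine mul_le_mul_of_nonneg_right ?_ hK0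
      calc K ^ (q / 2 - 1) ≤ (a ^ 2) ^ (q / 2 - 1) :=
            Real.rpow_le_rpow hK0 hlt.le (by linarith)
        _ = a ^ (q - 2) := by
            rw [← Real.rpow_natCast a 2, ← Real.rpow_mul ha]
            congr 1
            push_cast
            ring
    calc b ^ q = (b ^ 2) ^ (q / 2) := e1
      _ ≤ (K * (1 - 1 / q)) ^ (q / 2) :=
          Real.rpow_le_rpow (sq_nonneg b) (e2 ▸ hb2) (by linarith)
      _ = K ^ (q / 2) * (1 - 1 / q) ^ (q / 2) := Real.mul_rpow hK0 hq'
      _ ≤ a ^ (q - 2) * K * Real.exp (-(1 / 2)) :=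
          mul_le_mul e3 (one_sub_inv_rpow_le_exp hq) (Real.rpow_nonneg hq' _) (by positivity)
  have hsc : 0 < Real.sqrt c := Real.sqrt_pos.2 hc0
  have h2 : (a + s * Real.sqrt (v / q)) ^ (q - 2)
      ≤ a ^ (q - 2) * Real.exp (s / Real.sqrt c) := by
    -- This is `a² ≥ c q v` again: it turns the additive term into a factor `1 + s / (√c q)`, whose
    -- power `q - 2` is at most `e^(s/√c)`.
    have e1 : Real.sqrt (v / q) ≤ a / (q * Real.sqrt c) := by
      refine Real.sqrt_le_iff.2 ⟨by positivity, ?_⟩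
      rw [div_pow, mul_pow, Real.sq_sqrt hc0.le, div_le_div_iff₀ hq0 (by positivity)]
      have : K * q ≤ a ^ 2 * q := mul_le_mul_of_nonneg_right hlt.le hq0.le
      rw [hK] at this
      linarith
    have e2 : a + s * Real.sqrt (v / q) ≤ a * (1 + s / Real.sqrt c / q) := by
      have : s * Real.sqrt (v / q) ≤ s * (a / (q * Real.sqrt c)) :=
        mul_le_mul_of_nonneg_left e1 hs
      have e3 : s * (a / (q * Real.sqrt c)) = a * (s / Real.sqrt c / q) := by
        field_simp
      linarith
    have hsc' : 0 ≤ s / Real.sqrt c := by positivity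
    calc (a + s * Real.sqrt (v / q)) ^ (q - 2)
        ≤ (a * (1 + s / Real.sqrt c / q)) ^ (q - 2) :=
          Real.rpow_le_rpow (by positivity) e2 (by linarith)
      _ = a ^ (q - 2) * (1 + s / Real.sqrt c / q) ^ (q - 2) :=
          Real.mul_rpow ha (by positivity)
      _ ≤ _ := mul_le_mul_of_nonneg_left (one_add_div_rpow_le_exp hq hsc') hP.le
  have h3 : q / 2 * (v * (a + s * Real.sqrt (v / q)) ^ (q - 2))
      ≤ a ^ (q - 2) * K * (1 / (2 * c) * Real.exp (s / Real.sqrt c)) := by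
    calc _ ≤ q / 2 * (v * (a ^ (q - 2) * Real.exp (s / Real.sqrt c))) := by gcongr
      _ = _ := by
        rw [hK]
        field_simp
  have h4 : a ^ (q - 2) * a ^ 2 ≤ a ^ (q - 2) * K := by
    calc a ^ (q - 2) * a ^ 2
        ≤ a ^ (q - 2) * K
          * (Real.exp (-(1 / 2)) + 1 / (2 * c) * Real.exp (s / Real.sqrt c)) := by
          rw [mul_add, ← hsplit]
          linarith
      _ ≤ a ^ (q - 2) * K * 1 := mul_le_mul_of_nonneg_left hconst (by positivity)
      _ = _ := mul_one _
  exact absurd (le_of_mul_le_mul_left h4 hP) (not_le.2 hlt)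

/-- Induction over unit-length ranges of the real exponent, starting from `[1, 2]`. The cap `q₀` is
there because `v` will be tied to the final exponent and controls only smaller ones. -/
theorem moment_recurrence {a : ℝ → ℝ} {v c s q₀ : ℝ} (hv : 0 ≤ v) (ha : ∀ q, 0 ≤ a q)
    (hs : 0 ≤ s) (hc : 1 ≤ c)
    (hconst : Real.exp (-(1 / 2)) + 1 / (2 * c) * Real.exp (s / Real.sqrt c) ≤ 1)
    (hbase : ∀ q, 1 ≤ q → q ≤ 2 → a q ^ 2 ≤ v)
    (hrec : ∀ q, 2 ≤ q → q ≤ q₀ →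
      a q ^ q ≤ a (q - 1) ^ q + q / 2 * (v * (a q + s * Real.sqrt (v / q)) ^ (q - 2)))
    {q : ℝ} (hq : 1 ≤ q) (hq₀ : q ≤ q₀) : a q ^ 2 ≤ c * q * v := by
  have main : ∀ k : ℕ, ∀ q, 1 ≤ q → q ≤ q₀ → q ≤ k + 2 → a q ^ 2 ≤ c * q * v := by
    have base : ∀ q, 1 ≤ q → q ≤ 2 → a q ^ 2 ≤ c * q * v := by
      intro q h1 h2
      have : 1 ≤ c * q := by nlinarith
      nlinarith [hbase q h1 h2]
    intro k
    induction k with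
    | zero => exact fun q h1 _ h3 => base q h1 (by simpa using h3)
    | succ k ih =>
      intro q h1 h2 h3
      rcases le_total q 2 with h | h
      · exact base q h1 h
      · push_cast at h3
        exact sq_le_of_moment_recurrence h hv (ha q) (ha (q - 1)) hs hc hconst
          (ih (q - 1) (by linarith) (by linarith) (by linarith)) (hrec q h h2)
  obtain ⟨k, hk⟩ := exists_nat_ge q
  exact main k q hq hq₀ (by linarith)

/-! ### The constants `κ` and `C₂`. -/

theorem sqrt_exp_one : Real.sqrt (Real.exp 1) = Real.exp (1 / 2) := by
  rw [Real.sqrt_eq_iff_mul_self_eq (Real.exp_pos _).le (Real.exp_pos _).le, ← Real.exp_add]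
  norm_num

theorem exp_half_gt : (1.6 : ℝ) < Real.exp (1 / 2) := by
  rw [← sqrt_exp_one]
  refine Real.lt_sqrt_of_sq_lt ?_
  have := Real.exp_one_gt_d9
  norm_num at this ⊢
  linarith

theorem exp_half_lt : Real.exp (1 / 2) < (1.66 : ℝ) := by
  rw [← sqrt_exp_one]
  refine (Real.sqrt_lt' (by norm_num)).2 ?_
  have := Real.exp_one_lt_d9
  norm_num at this ⊢
  linarith

theorem kappaConst_ge_one : 1 ≤ kappaConst := by
  unfold kappaConst
  rw [sqrt_exp_one]
  have h1 := exp_half_gt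
  have h2 := exp_half_lt
  rw [le_div_iff₀ (by linarith)]
  linarith

theorem kappaConst_le_two : kappaConst ≤ 2 := by
  unfold kappaConst
  rw [sqrt_exp_one]
  have h1 := exp_half_gt
  rw [div_le_iff₀ (by linarith)]
  linarith

theorem kappaConst_equation :
    Real.exp (-(1 / 2)) + 1 / (2 * kappaConst) * Real.exp (0 / Real.sqrt kappaConst) = 1 := by
  have h1 := exp_half_gt
  have h3 : Real.exp (1 / 2) - 1 ≠ 0 := by linarith
  have h4 : Real.exp (1 / 2) ≠ 0 := by linarith
  rw [zero_div, Real.exp_zero, Real.exp_neg]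
  unfold kappaConst
  rw [sqrt_exp_one]
  field_simp
  ring

theorem cTwo_pos : 0 < cTwo := cTwo_existsUnique.choose_spec.1.1

theorem cTwoFun_cTwo : cTwoFun cTwo = 0 := cTwo_existsUnique.choose_spec.1.2

theorem cTwo_ge_one : 1 ≤ cTwo := by
  by_contra! h
  have h1 := cTwoFun_strictAntiOn cTwo_pos (Set.mem_Ioi.2 one_pos) h
  rw [cTwoFun_cTwo] at h1
  unfold cTwoFun at h1
  simp only [Real.sqrt_one, div_one, mul_one] at h1
  have := Real.exp_pos (-(1 / 2))
  have := Real.add_one_le_exp (1 : ℝ)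
  linarith

theorem cTwo_equation :
    Real.exp (-(1 / 2)) + 1 / (2 * cTwo) * Real.exp (1 / Real.sqrt cTwo) = 1 := by
  have := cTwoFun_cTwo
  unfold cTwoFun at this
  linarith

theorem cTwo_lt : cTwo < 2.42 := by
  by_contra! h
  have h1 := cTwoFun_strictAntiOn.antitoneOn (Set.mem_Ioi.2 (by norm_num : (0 : ℝ) < 2.42))
    cTwo_pos h
  rw [cTwoFun_cTwo] at h1
  -- The target is `0.6066 + 1.902 / 4.84 < 1`; the margin is below `5 · 10⁻⁴`, which dictates the
  -- precision of these bounds.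
  have hs : (1.5556 : ℝ) ≤ Real.sqrt 2.42 := by
    refine Real.le_sqrt_of_sq_le ?_
    norm_num
  have h2 : 1 / Real.sqrt 2.42 ≤ 0.64285 := by
    rw [div_le_iff₀ (by linarith)]
    linarith
  have h3 : Real.exp 0.64285 ≤ 1.902 := by
    have := Real.exp_bound' (x := (0.64285 : ℝ)) (by norm_num) (by norm_num) (n := 7)
      (by norm_num)
    refine this.trans ?_
    norm_num [Finset.sum_range_succ, Nat.factorial]
  have h4 : Real.exp (-(1 / 2)) ≤ 0.6066 := by
    rw [Real.exp_neg, inv_le_comm₀ (Real.exp_pos _) (by norm_num), ← sqrt_exp_one]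
    refine Real.le_sqrt_of_sq_le ?_
    refine le_trans ?_ Real.exp_one_gt_d9.le
    norm_num
  have h5 := (Real.exp_le_exp.2 h2).trans h3
  unfold cTwoFun at h1
  norm_num at h1 h4 h5
  linarith

/-! ### Tensorization of the power entropy. -/

/-- For `u > 0` this is Bernoulli's inequality at `(y - u) / u`, multiplied by `u ^ p`. -/
theorem bregmanPow_nonneg {p y u : ℝ} (hp : 1 < p) (hy : 0 ≤ y) (hu : 0 ≤ u) :
    0 ≤ bregmanPow p y u := by
  unfold bregmanPow
  rcases hu.eq_or_lt with rfl | hu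
  · rw [Real.zero_rpow (by linarith), Real.zero_rpow (by linarith)]
    simpa using Real.rpow_nonneg hy p
  · have h := one_add_mul_self_le_rpow_one_add (s := (y - u) / u)
      (by rw [le_div_iff₀ hu]; linarith) hp.le
    have e1 : 1 + (y - u) / u = y / u := by field_simp; ring
    have e2 : u ^ p = u ^ (p - 1) * u := by
      rw [← Real.rpow_add_one hu.ne', sub_add_cancel]
    rw [e1, Real.div_rpow hy hu.le, le_div_iff₀ (Real.rpow_pos_of_pos hu _)] at h
    have e3 : (1 + p * ((y - u) / u)) * u ^ p = u ^ p + p * u ^ (p - 1) * (y - u) := by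
      rw [add_mul, e2]
      field_simp
    linarith

section Tensorization

variable {α β : Type*} [MeasurableSpace α] [MeasurableSpace β]

theorem integrable_of_mem_Icc {ν : Measure α} [IsFiniteMeasure ν] {f : α → ℝ} {A B : ℝ}
    (hf : Measurable f) (h : ∀ x, f x ∈ Set.Icc A B) : Integrable f ν :=
  Integrable.of_mem_Icc A B hf.aemeasurable (Filter.Eventually.of_forall h)

theorem integral_mem_Icc {ν : Measure α} [IsProbabilityMeasure ν] {f : α → ℝ} {B : ℝ}
    (hf : Measurable f) (h : ∀ x, f x ∈ Set.Icc 0 B) : ∫ x, f x ∂ν ∈ Set.Icc 0 B := by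
  refine ⟨integral_nonneg fun x => (h x).1, ?_⟩
  calc ∫ x, f x ∂ν ≤ ∫ _, B ∂ν :=
        integral_mono (integrable_of_mem_Icc hf h) (integrable_const B) fun x => (h x).2
    _ = B := by simp

theorem measurable_bregmanPow {p : ℝ} (hp : 1 < p) {f g : α → ℝ} (hf : Measurable f)
    (hg : Measurable g) : Measurable fun x => bregmanPow p (f x) (g x) :=
  (continuous_bregmanPow hp).measurable.comp (hf.prodMk hg)

theorem exists_bregmanPow_mem_Icc {p : ℝ} (hp : 1 < p) (B : ℝ) :
    ∃ C, ∀ y ∈ Set.Icc 0 B, ∀ u ∈ Set.Icc 0 B, bregmanPow p y u ∈ Set.Icc 0 C := by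
  obtain ⟨C, hC⟩ := ((isCompact_Icc (a := (0 : ℝ)) (b := B)).prod
    (isCompact_Icc (a := (0 : ℝ)) (b := B))).bddAbove_image
    (continuous_bregmanPow hp).continuousOn
  exact ⟨C, fun y hy u hu => ⟨bregmanPow_nonneg hp hy.1 hu.1,
    hC (Set.mem_image_of_mem _ (Set.mk_mem_prod hy hu))⟩⟩

theorem rpow_mem_Icc {p y B : ℝ} (hp : 0 ≤ p) (hy : y ∈ Set.Icc 0 B) :
    y ^ p ∈ Set.Icc 0 (B ^ p) :=
  ⟨Real.rpow_nonneg hy.1 p, Real.rpow_le_rpow hy.1 hy.2 hp⟩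

/-- Joint Jensen inequality for the Bregman divergence. -/
theorem bregmanPow_integral_le {p B : ℝ} (hp1 : 1 < p) (hp2 : p ≤ 2) {ν : Measure α}
    [IsProbabilityMeasure ν] {f g : α → ℝ} (hf : Measurable f) (hg : Measurable g)
    (hfB : ∀ x, f x ∈ Set.Icc 0 B) (hgB : ∀ x, g x ∈ Set.Icc 0 B) :
    bregmanPow p (∫ x, f x ∂ν) (∫ x, g x ∂ν) ≤ ∫ x, bregmanPow p (f x) (g x) ∂ν := by
  obtain ⟨C, hC⟩ := exists_bregmanPow_mem_Icc hp1 B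
  have hif := integrable_of_mem_Icc (ν := ν) hf hfB
  have hig := integrable_of_mem_Icc (ν := ν) hg hgB
  have h := (convexOn_bregmanPow hp1 hp2).map_integral_le (μ := ν) (f := fun x => (f x, g x))
    (continuous_bregmanPow hp1).continuousOn (isClosed_Ici.prod isClosed_Ici)
    (Filter.Eventually.of_forall fun x => ⟨(hfB x).1, (hgB x).1⟩) (hif.prodMk hig)
    (integrable_of_mem_Icc (measurable_bregmanPow hp1 hf hg)
      fun x => hC _ (hfB x) _ (hgB x))
  rwa [integral_pair hif hig] at h

/-- The right side exceeds the left by exactly the divergence of `∫ f` from `c`, which is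
nonnegative. -/
theorem integral_rpow_sub_rpow_integral_le {p B c : ℝ} (hp : 1 < p) {ν : Measure α}
    [IsProbabilityMeasure ν] {f : α → ℝ} (hf : Measurable f)
    (hfB : ∀ x, f x ∈ Set.Icc 0 B) (hc : 0 ≤ c) :
    ∫ x, f x ^ p ∂ν - (∫ x, f x ∂ν) ^ p ≤ ∫ x, bregmanPow p (f x) c ∂ν := by
  have hif := integrable_of_mem_Icc (ν := ν) hf hfB
  have hifp := integrable_of_mem_Icc (ν := ν) (hf.pow_const p)
    fun x => rpow_mem_Icc (by linarith) (hfB x)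
  have h0 := bregmanPow_nonneg hp (integral_nonneg (μ := ν) fun x => (hfB x).1) hc
  have e : ∫ x, bregmanPow p (f x) c ∂ν
      = ∫ x, f x ^ p ∂ν - c ^ p - p * c ^ (p - 1) * (∫ x, f x ∂ν - c) := by
    unfold bregmanPow
    have i1 : Integrable (fun x => f x ^ p - c ^ p) ν := hifp.sub (integrable_const _)
    have i2 : Integrable (fun x => p * c ^ (p - 1) * (f x - c)) ν :=
      (hif.sub (integrable_const _)).const_mul _
    rw [integral_sub i1 i2,
      integral_sub hifp (integrable_const _), integral_const_mul,
      integral_sub hif (integrable_const _)]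
    simp
  rw [e]
  unfold bregmanPow at h0
  linarith

theorem measurable_finCons {n : ℕ} :
    Measurable fun z : α × (Fin n → α) => (Fin.cons z.1 z.2 : Fin (n + 1) → α) := by
  refine measurable_pi_lambda _ fun i => ?_
  refine Fin.cases ?_ (fun j => ?_) i
  · simpa using measurable_fst
  · simp only [Fin.cons_succ]
    exact (measurable_pi_apply j).comp measurable_snd

theorem integral_pi_succ {n : ℕ} (ν : Fin (n + 1) → Measure α)
    [∀ i, IsProbabilityMeasure (ν i)] {f : (Fin (n + 1) → α) → ℝ} {A B : ℝ}
    (hf : Measurable f) (h : ∀ x, f x ∈ Set.Icc A B) :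
    ∫ x, f x ∂(Measure.pi ν)
      = ∫ a, ∫ x, f (Fin.cons a x) ∂(Measure.pi fun j => ν j.succ) ∂(ν 0) := by
  have hmp := measurePreserving_piFinSuccAbove ν 0
  rw [← integral_prod (fun z : α × (Fin n → α) => f (Fin.cons z.1 z.2))
    (integrable_of_mem_Icc (hf.comp measurable_finCons) fun z => h _)]
  have := hmp.symm.integral_comp' (g := f)
  simp only [Fin.zero_succAbove] at this
  rw [← this]
  refine integral_congr_ae (Filter.Eventually.of_forall fun z => ?_)
  change f (Fin.insertNth 0 z.1 z.2) = f (Fin.cons z.1 z.2)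
  rw [Fin.insertNth_zero']

/-- Tensorization of the entropy associated with `t ↦ t ^ p`, `1 < p ≤ 2`. -/
theorem entropy_pi_le {p B : ℝ} (hp1 : 1 < p) (hp2 : p ≤ 2) (n : ℕ) (ν : Fin n → Measure α)
    [∀ i, IsProbabilityMeasure (ν i)] (H : (Fin n → α) → ℝ) (K : Fin n → (Fin n → α) → ℝ)
    (hH : Measurable H) (hK : ∀ i, Measurable (K i)) (hHB : ∀ x, H x ∈ Set.Icc 0 B)
    (hKB : ∀ i x, K i x ∈ Set.Icc 0 B)
    (hKi : ∀ i x a, K i (Function.update x i a) = K i x) :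
    ∫ x, H x ^ p ∂(Measure.pi ν) - (∫ x, H x ∂(Measure.pi ν)) ^ p
      ≤ ∑ i, ∫ x, bregmanPow p (H x) (K i x) ∂(Measure.pi ν) := by
  induction n with
  | zero =>
    have e : H = fun _ => H default := funext fun x => by rw [Subsingleton.elim x default]
    rw [e]
    simp
  | succ n ih =>
    obtain ⟨C, hC⟩ := exists_bregmanPow_mem_Icc hp1 B
    have hp0 : 0 ≤ p := by linarith
    set ρ := Measure.pi fun j : Fin n => ν j.succ with hρ
    have hcons : ∀ a : α, Measurable fun x : Fin n → α => (Fin.cons a x : Fin (n + 1) → α) :=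
      fun a => measurable_finCons.comp (measurable_const.prodMk measurable_id)
    have hmeas : ∀ {f : (Fin (n + 1) → α) → ℝ}, Measurable f →
        Measurable fun a => ∫ x, f (Fin.cons a x) ∂ρ := fun hf =>
      ((hf.comp measurable_finCons).stronglyMeasurable.integral_prod_right'
        (ν := ρ)).measurable
    have hDm : ∀ i, Measurable fun x => bregmanPow p (H x) (K i x) :=
      fun i => measurable_bregmanPow hp1 hH (hK i)
    have hDB : ∀ i x, bregmanPow p (H x) (K i x) ∈ Set.Icc 0 C :=
      fun i x => hC _ (hHB x) _ (hKB i x)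
    have hHp : Measurable fun x => H x ^ p := hH.pow_const p
    have hHpB : ∀ x, H x ^ p ∈ Set.Icc 0 (B ^ p) := fun x => rpow_mem_Icc hp0 (hHB x)
    set g : α → ℝ := fun a => ∫ x, H (Fin.cons a x) ∂ρ with hg
    have hgm : Measurable g := hmeas hH
    have hgB : ∀ a, g a ∈ Set.Icc 0 B :=
      fun a => integral_mem_Icc (hH.comp (hcons a)) fun x => hHB _
    obtain ⟨a₀⟩ : Nonempty α := nonempty_of_isProbabilityMeasure (ν 0)
    -- `K 0` ignores coordinate 0, so its integral over the others is one constant `c`, whatever the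
    -- fibre `a₀`. Entropy splits into the entropy on fibres (induction hypothesis) and that of `g`;
    -- the latter is bounded by the divergence from `c`, then by joint Jensen.
    set c : ℝ := ∫ x, K 0 (Fin.cons a₀ x) ∂ρ with hc
    have hc0 : 0 ≤ c := integral_nonneg fun x => (hKB 0 _).1
    have hcK : ∀ a, ∫ x, K 0 (Fin.cons a x) ∂ρ = c := by
      intro a
      refine integral_congr_ae (Filter.Eventually.of_forall fun x => ?_)
      have := hKi 0 (Fin.cons a₀ x) a
      rwa [Fin.update_cons_zero] at this
    have step1 : ∀ a, ∫ x, H (Fin.cons a x) ^ p ∂ρ - g a ^ p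
        ≤ ∑ i : Fin n, ∫ x, bregmanPow p (H (Fin.cons a x)) (K i.succ (Fin.cons a x)) ∂ρ := by
      intro a
      refine ih (fun j => ν j.succ) (fun x => H (Fin.cons a x))
        (fun i x => K i.succ (Fin.cons a x)) (hH.comp (hcons a))
        (fun i => (hK _).comp (hcons a)) (fun x => hHB _) (fun i x => hKB _ _) ?_
      intro i x b
      have := hKi i.succ (Fin.cons a x) b
      rwa [← Fin.cons_update] at this
    have step2 : ∀ a, bregmanPow p (g a) c
        ≤ ∫ x, bregmanPow p (H (Fin.cons a x)) (K 0 (Fin.cons a x)) ∂ρ := by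
      intro a
      rw [← hcK a]
      exact bregmanPow_integral_le hp1 hp2 (hH.comp (hcons a)) ((hK 0).comp (hcons a))
        (fun x => hHB _) fun x => hKB 0 _
    have step3 := integral_rpow_sub_rpow_integral_le (ν := ν 0) hp1 hgm hgB hc0
    have hcB : c ∈ Set.Icc 0 B :=
      integral_mem_Icc ((hK 0).comp (hcons a₀)) fun x => hKB 0 _
    have iD : ∀ i, Integrable
        (fun a => ∫ x, bregmanPow p (H (Fin.cons a x)) (K i (Fin.cons a x)) ∂ρ) (ν 0) :=
      fun i => integrable_of_mem_Icc (hmeas (hDm i)) fun a =>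
        integral_mem_Icc ((hDm i).comp (hcons a)) fun x => hDB i _
    have iH : Integrable (fun a => ∫ x, H (Fin.cons a x) ^ p ∂ρ) (ν 0) :=
      integrable_of_mem_Icc (hmeas hHp) fun a =>
        integral_mem_Icc (hHp.comp (hcons a)) fun x => hHpB _
    have ig : Integrable (fun a => g a ^ p) (ν 0) :=
      integrable_of_mem_Icc (hgm.pow_const p) fun a => rpow_mem_Icc hp0 (hgB a)
    have int1 := integral_mono (iH.sub ig) (integrable_finsetSum _ fun i _ => iD i.succ) step1
    have int2 := integral_mono (integrable_of_mem_Icc (ν := ν 0)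
      (measurable_bregmanPow hp1 hgm measurable_const) fun a => hC _ (hgB a) _ hcB)
      (iD 0) step2
    rw [integral_finsetSum _ fun i _ => iD i.succ] at int1
    simp only [Pi.sub_apply] at int1
    rw [integral_sub iH ig] at int1
    rw [integral_pi_succ ν hHp hHpB, integral_pi_succ ν hH hHB, Fin.sum_univ_succ]
    simp only [integral_pi_succ ν (hDm _) (hDB _)]
    linarith

end Tensorization

/-! ### Entropy inequalities for functions of independent variables. -/

theorem varV_mem_Icc {Ω 𝒳 : Type*} {n : ℕ} {X : Fin n → Ω → 𝒳} {F : (Fin n → 𝒳) → ℝ}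
    {G : (i : Fin n) → ({j : Fin n // j ≠ i} → 𝒳) → ℝ} {B : ℝ}
    (hFB : ∀ x, F x ∈ Set.Icc 0 B) (hGB : ∀ i x, G i x ∈ Set.Icc 0 B) (ω : Ω) :
    varV F G X ω ∈ Set.Icc 0 (n * B ^ 2) := by
  refine ⟨Finset.sum_nonneg fun i _ => sq_nonneg _, ?_⟩
  calc varV F G X ω ≤ ∑ _i : Fin n, B ^ 2 := by
        refine Finset.sum_le_sum fun i _ => sq_le_sq' ?_ ?_
        · have h1 := (hFB fun j => X j ω).1
          have h2 := (hGB i fun j => X j.1 ω).2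
          unfold varZ varZi
          linarith
        · have h1 := (hFB fun j => X j ω).2
          have h2 := (hGB i fun j => X j.1 ω).1
          unfold varZ varZi
          linarith
    _ = n * B ^ 2 := by simp

section Independent

variable {Ω 𝒳 : Type*} [MeasurableSpace Ω] [MeasurableSpace 𝒳] {μ : Measure Ω}
  [IsProbabilityMeasure μ] {n : ℕ} {X : Fin n → Ω → 𝒳}

theorem measurable_varZ {F : (Fin n → 𝒳) → ℝ} (hX : ∀ i, Measurable (X i))
    (hF : Measurable F) : Measurable (varZ F X) :=
  hF.comp (measurable_pi_lambda _ hX)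

theorem measurable_varZi {G : (i : Fin n) → ({j : Fin n // j ≠ i} → 𝒳) → ℝ}
    (hX : ∀ i, Measurable (X i)) (hG : ∀ i, Measurable (G i)) (i : Fin n) :
    Measurable (varZi G X i) :=
  (hG i).comp (measurable_pi_lambda _ fun j => hX j.1)

theorem measurable_varV {F : (Fin n → 𝒳) → ℝ}
    {G : (i : Fin n) → ({j : Fin n // j ≠ i} → 𝒳) → ℝ} (hX : ∀ i, Measurable (X i))
    (hF : Measurable F) (hG : ∀ i, Measurable (G i)) : Measurable (varV F G X) :=
  Finset.measurable_sum _ fun i _ =>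
    ((measurable_varZ hX hF).sub (measurable_varZi hX hG i)).pow_const 2

/-- Tensorization of the entropy for functions of independent random variables. -/
theorem entropy_iIndepFun_le {p B : ℝ} (hp1 : 1 < p) (hp2 : p ≤ 2)
    (hX : ∀ i, Measurable (X i)) (hindep : iIndepFun X μ)
    {H : (Fin n → 𝒳) → ℝ} {K : (i : Fin n) → ({j : Fin n // j ≠ i} → 𝒳) → ℝ}
    (hH : Measurable H) (hK : ∀ i, Measurable (K i)) (hHB : ∀ x, H x ∈ Set.Icc 0 B)
    (hKB : ∀ i x, K i x ∈ Set.Icc 0 B) :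
    ∫ ω, varZ H X ω ^ p ∂μ - (∫ ω, varZ H X ω ∂μ) ^ p
      ≤ ∑ i, ∫ ω, bregmanPow p (varZ H X ω) (varZi K X i ω) ∂μ := by
  have hmap := (iIndepFun_iff_map_fun_eq_pi_map fun i => (hX i).aemeasurable).1 hindep
  have hXm : Measurable fun ω i => X i ω := measurable_pi_lambda _ hX
  have := fun i => Measure.isProbabilityMeasure_map (μ := μ) (hX i).aemeasurable
  have hres : ∀ i : Fin n,
      Measurable fun (x : Fin n → 𝒳) (j : {j : Fin n // j ≠ i}) => x j.1 := fun i =>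
    measurable_pi_lambda _ fun j => measurable_pi_apply j.1
  have h := entropy_pi_le (B := B) hp1 hp2 n (fun i => μ.map (X i)) H
    (fun i x => K i fun j => x j.1) hH (fun i => (hK i).comp (hres i)) hHB
    (fun i x => hKB i _) (by
      intro i x a
      congr 1
      funext j
      exact Function.update_of_ne j.2 a x)
  rw [← hmap] at h
  have hint : ∀ f : (Fin n → 𝒳) → ℝ, Measurable f →
      ∫ x, f x ∂(μ.map fun ω i => X i ω) = ∫ ω, f (fun i => X i ω) ∂μ := fun f hf =>
    integral_map hXm.aemeasurable hf.aestronglyMeasurable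
  rw [hint _ (hH.pow_const p), hint _ hH] at h
  refine h.trans_eq (Finset.sum_congr rfl fun i _ => ?_)
  exact hint _ (measurable_bregmanPow hp1 hH ((hK i).comp (hres i)))

/-- Efron–Stein: the case `p = 2` of the entropy bound, where the divergence is `(y - u)²`. -/
theorem variance_le_integral_varV {B : ℝ} (hX : ∀ i, Measurable (X i))
    (hindep : iIndepFun X μ) {F : (Fin n → 𝒳) → ℝ}
    {G : (i : Fin n) → ({j : Fin n // j ≠ i} → 𝒳) → ℝ}
    (hF : Measurable F) (hG : ∀ i, Measurable (G i)) (hFB : ∀ x, F x ∈ Set.Icc 0 B)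
    (hGB : ∀ i x, G i x ∈ Set.Icc 0 B) :
    ∫ ω, (varZ F X ω - ∫ ω', varZ F X ω' ∂μ) ^ 2 ∂μ ≤ ∫ ω, varV F G X ω ∂μ := by
  have h := entropy_iIndepFun_le (p := 2) (by norm_num) le_rfl hX hindep hF hG hFB hGB
  have hZm := measurable_varZ hX hF
  have e : ∀ y u, bregmanPow 2 y u = (y - u) ^ 2 := by
    intro y u
    unfold bregmanPow
    rw [Real.rpow_two, Real.rpow_two, show (2 : ℝ) - 1 = 1 by norm_num, Real.rpow_one]
    ring
  simp only [e, Real.rpow_two] at h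
  have hi : Integrable (varZ F X) μ := integrable_of_mem_Icc hZm fun ω => hFB _
  have hi2 : Integrable (fun ω => varZ F X ω ^ 2) μ :=
    integrable_of_mem_Icc (hZm.pow_const 2) fun ω =>
      ⟨sq_nonneg _, pow_le_pow_left₀ (hFB fun j => X j ω).1 (hFB fun j => X j ω).2 2⟩
  have hisum : ∀ i : Fin n, Integrable (fun ω => (varZ F X ω - varZi G X i ω) ^ 2) μ := by
    intro i
    refine integrable_of_mem_Icc (A := 0) (B := B ^ 2)
      ((hZm.sub (measurable_varZi hX hG i)).pow_const 2) fun ω => ⟨sq_nonneg _, ?_⟩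
    have h1 := hFB fun j => X j ω
    have h2 := hGB i fun j => X j.1 ω
    refine sq_le_sq' ?_ ?_ <;> unfold varZ varZi <;> linarith [h1.1, h1.2, h2.1, h2.2]
  set m := ∫ ω', varZ F X ω' ∂μ with hm
  have e2 : ∫ ω, (varZ F X ω - m) ^ 2 ∂μ = ∫ ω, varZ F X ω ^ 2 ∂μ - m ^ 2 := by
    have e3 : ∀ ω, (varZ F X ω - m) ^ 2 = varZ F X ω ^ 2 - (2 * m * varZ F X ω - m ^ 2) :=
      fun ω => by ring
    simp only [e3]
    have i2 : Integrable (fun ω => 2 * m * varZ F X ω - m ^ 2) μ :=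
      (hi.const_mul _).sub (integrable_const _)
    rw [integral_sub hi2 i2, integral_sub (hi.const_mul _) (integrable_const _),
      integral_const_mul, ← hm]
    simp
    ring
  rw [e2]
  unfold varV
  rw [integral_finsetSum _ fun i _ => hisum i]
  exact h

/-- The entropy bound for `(q - 1)`-th powers with exponent `q / (q - 1)`, which lies in `(1, 2]`
because `q ≥ 2`. `T` dominates both `φ(Z)` and every `φ(Zᵢ)`, hence their maximum. -/
theorem integral_rpow_le_of_contraction {B C m q : ℝ} (hq : 2 ≤ q)
    (hX : ∀ i, Measurable (X i)) (hindep : iIndepFun X μ) {F : (Fin n → 𝒳) → ℝ}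
    {G : (i : Fin n) → ({j : Fin n // j ≠ i} → 𝒳) → ℝ}
    (hF : Measurable F) (hG : ∀ i, Measurable (G i)) (hFB : ∀ x, F x ∈ Set.Icc 0 B)
    (hGB : ∀ i x, G i x ∈ Set.Icc 0 B)
    {φ : ℝ → ℝ} (hφ : Measurable φ) (hφB : ∀ z ∈ Set.Icc 0 B, φ z ∈ Set.Icc 0 m)
    (hφL : ∀ x y, (φ x - φ y) ^ 2 ≤ (x - y) ^ 2) {T : Ω → ℝ} (hT : Measurable T)
    (hTC : ∀ ω, T ω ∈ Set.Icc 0 C) (hZT : ∀ ω, φ (varZ F X ω) ≤ T ω)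
    (hZiT : ∀ i, ∀ᵐ ω ∂μ, φ (varZi G X i ω) ≤ T ω) :
    ∫ ω, φ (varZ F X ω) ^ q ∂μ ≤ (∫ ω, φ (varZ F X ω) ^ (q - 1) ∂μ) ^ (q / (q - 1))
      + q / 2 * ∫ ω, varV F G X ω * T ω ^ (q - 2) ∂μ := by
  have hq1 : 0 < q - 1 := by linarith
  have hp1 : 1 < q / (q - 1) := by rw [lt_div_iff₀ hq1]; linarith
  have hp2 : q / (q - 1) ≤ 2 := by rw [div_le_iff₀ hq1]; linarith
  have hZm := measurable_varZ hX hF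
  have hZim := measurable_varZi hX hG
  have hφF : ∀ x, φ (F x) ∈ Set.Icc 0 m := fun x => hφB _ (hFB x)
  have hφG : ∀ i x, φ (G i x) ∈ Set.Icc 0 m := fun i x => hφB _ (hGB i x)
  have hH := (hφ.comp hF).pow_const (q - 1)
  have hK := fun i => (hφ.comp (hG i)).pow_const (q - 1)
  have h := entropy_iIndepFun_le (B := m ^ (q - 1)) hp1 hp2 hX hindep hH hK
    (fun x => rpow_mem_Icc hq1.le (hφF x)) (fun i x => rpow_mem_Icc hq1.le (hφG i x))
  have e1 : ∀ ω, varZ (fun x => (φ ∘ F) x ^ (q - 1)) X ω = φ (varZ F X ω) ^ (q - 1) :=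
    fun ω => rfl
  have e2 : ∀ i ω, varZi (fun i x => (φ ∘ G i) x ^ (q - 1)) X i ω
      = φ (varZi G X i ω) ^ (q - 1) := fun i ω => rfl
  simp only [e1, e2] at h
  have e3 : ∀ ω, (φ (varZ F X ω) ^ (q - 1)) ^ (q / (q - 1)) = φ (varZ F X ω) ^ q := by
    intro ω
    rw [← Real.rpow_mul (show 0 ≤ φ (varZ F X ω) from (hφF _).1)]
    congr 1
    field_simp
  simp only [e3] at h
  obtain ⟨D, hD⟩ := exists_bregmanPow_mem_Icc hp1 (m ^ (q - 1))
  have hiT : ∀ i, Integrable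
      (fun ω => q / 2 * ((varZ F X ω - varZi G X i ω) ^ 2 * T ω ^ (q - 2))) μ := by
    intro i
    refine (integrable_of_mem_Icc (A := 0) (B := B ^ 2 * C ^ (q - 2))
      (((hZm.sub (hZim i)).pow_const 2).mul (hT.pow_const _)) fun ω => ?_).const_mul _
    have h1 := hFB fun j => X j ω
    have h2 := hGB i fun j => X j.1 ω
    have h3 := rpow_mem_Icc (p := q - 2) (by linarith) (hTC ω)
    refine ⟨mul_nonneg (sq_nonneg _) h3.1, mul_le_mul ?_ h3.2 h3.1 (sq_nonneg _)⟩
    refine sq_le_sq' ?_ ?_ <;> simp only [Pi.sub_apply] <;> unfold varZ varZi <;>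
      linarith [h1.1, h1.2, h2.1, h2.2]
  have hterm : ∀ i, ∫ ω, bregmanPow (q / (q - 1)) (φ (varZ F X ω) ^ (q - 1))
      (φ (varZi G X i ω) ^ (q - 1)) ∂μ
      ≤ ∫ ω, q / 2 * ((varZ F X ω - varZi G X i ω) ^ 2 * T ω ^ (q - 2)) ∂μ := by
    intro i
    refine integral_mono_ae ?_ (hiT i) ?_
    · exact integrable_of_mem_Icc (measurable_bregmanPow hp1
        ((hφ.comp hZm).pow_const _) ((hφ.comp (hZim i)).pow_const _)) fun ω =>
        hD _ (rpow_mem_Icc hq1.le (hφF _)) _ (rpow_mem_Icc hq1.le (hφG i _))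
    · filter_upwards [hZiT i] with ω hω
      refine (bregmanPow_powDiff_le hq (hφF _).1 (hφG i _).1).trans ?_
      refine mul_le_mul_of_nonneg_left ?_ (by linarith)
      rw [mul_comm]
      refine mul_le_mul (hφL _ _) ?_ ?_ (sq_nonneg _)
      · exact Real.rpow_le_rpow (le_max_of_le_left (hφF _).1) (max_le (hZT ω) hω)
          (by linarith)
      · exact Real.rpow_nonneg (le_max_of_le_left (hφF _).1) _
  have hsum : q / 2 * ∫ ω, varV F G X ω * T ω ^ (q - 2) ∂μ
      = ∑ i, ∫ ω, q / 2 * ((varZ F X ω - varZi G X i ω) ^ 2 * T ω ^ (q - 2)) ∂μ := by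
    rw [← integral_finsetSum _ fun i _ => hiT i, ← integral_const_mul]
    simp only [varV, Finset.sum_mul, Finset.mul_sum]
  rw [hsum]
  have := Finset.sum_le_sum fun i (_ : i ∈ Finset.univ) => hterm i
  linarith

end Independent

/-! ### Norm inequalities for bounded nonnegative functions. -/

section Moments

variable {Ω : Type*} [MeasurableSpace Ω]

/-- The `L^q` norm of a bounded nonnegative function, as a real number. -/
noncomputable def realNorm (μ : Measure Ω) (f : Ω → ℝ) (q : ℝ) : ℝ :=
  (∫ ω, f ω ^ q ∂μ) ^ (1 / q)

variable {μ : Measure Ω} {f g : Ω → ℝ} {A B q r : ℝ}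

theorem realNorm_nonneg (hfB : ∀ ω, f ω ∈ Set.Icc 0 B) (q : ℝ) : 0 ≤ realNorm μ f q :=
  Real.rpow_nonneg (integral_nonneg fun ω => Real.rpow_nonneg (hfB ω).1 q) _

theorem realNorm_rpow (hfB : ∀ ω, f ω ∈ Set.Icc 0 B) (hq : 0 < q) :
    realNorm μ f q ^ q = ∫ ω, f ω ^ q ∂μ := by
  unfold realNorm
  rw [← Real.rpow_mul (integral_nonneg fun ω => Real.rpow_nonneg (hfB ω).1 q),
    one_div_mul_cancel hq.ne', Real.rpow_one]

variable [IsProbabilityMeasure μ]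

theorem eLpNorm_eq_realNorm (hf : Measurable f) (hfB : ∀ ω, f ω ∈ Set.Icc 0 B)
    (hq : 0 < q) : eLpNorm f (ENNReal.ofReal q) μ = ENNReal.ofReal (realNorm μ f q) := by
  have hmem : MemLp f (ENNReal.ofReal q) μ :=
    MemLp.of_bound hf.aestronglyMeasurable B (Filter.Eventually.of_forall fun ω => by
      rw [Real.norm_of_nonneg (hfB ω).1]
      exact (hfB ω).2)
  rw [hmem.eLpNorm_eq_integral_rpow_norm (by simpa using hq) ENNReal.ofReal_ne_top,
    ENNReal.toReal_ofReal hq.le, realNorm, one_div]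
  congr 3
  funext ω
  rw [Real.norm_of_nonneg (hfB ω).1]

theorem realNorm_mono_exponent (hf : Measurable f) (hfB : ∀ ω, f ω ∈ Set.Icc 0 B)
    (hq : 0 < q) (hqr : q ≤ r) : realNorm μ f q ≤ realNorm μ f r := by
  have h := eLpNorm_le_eLpNorm_of_exponent_le (μ := μ) (ENNReal.ofReal_le_ofReal hqr)
    hf.aestronglyMeasurable
  rw [eLpNorm_eq_realNorm hf hfB hq, eLpNorm_eq_realNorm hf hfB (hq.trans_le hqr)] at h
  exact (ENNReal.ofReal_le_ofReal_iff (realNorm_nonneg hfB r)).1 h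

theorem realNorm_add_le (hf : Measurable f) (hfA : ∀ ω, f ω ∈ Set.Icc 0 A)
    (hg : Measurable g) (hgB : ∀ ω, g ω ∈ Set.Icc 0 B) (hq : 1 ≤ q) :
    realNorm μ (fun ω => f ω + g ω) q ≤ realNorm μ f q + realNorm μ g q := by
  have hfg : ∀ ω, f ω + g ω ∈ Set.Icc 0 (A + B) := fun ω =>
    ⟨add_nonneg (hfA ω).1 (hgB ω).1, add_le_add (hfA ω).2 (hgB ω).2⟩
  have hq0 : 0 < q := by linarith
  have h := eLpNorm_add_le (μ := μ) (p := ENNReal.ofReal q) hf.aestronglyMeasurable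
    hg.aestronglyMeasurable (by simpa using hq)
  rw [show f + g = fun ω => f ω + g ω from rfl, eLpNorm_eq_realNorm hf hfA hq0,
    eLpNorm_eq_realNorm hg hgB hq0, eLpNorm_eq_realNorm (f := fun ω => f ω + g ω) (hf.add hg) hfg hq0,
    ← ENNReal.ofReal_add (realNorm_nonneg hfA q) (realNorm_nonneg hgB q)] at h
  exact (ENNReal.ofReal_le_ofReal_iff
    (add_nonneg (realNorm_nonneg hfA q) (realNorm_nonneg hgB q))).1 h

theorem integral_mul_rpow_le (hf : Measurable f) (hfA : ∀ ω, f ω ∈ Set.Icc 0 A)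
    (hg : Measurable g) (hgB : ∀ ω, g ω ∈ Set.Icc 0 B) (hq : 2 ≤ q) :
    ∫ ω, f ω * g ω ^ (q - 2) ∂μ ≤ realNorm μ f (q / 2) * realNorm μ g q ^ (q - 2) := by
  -- Hölder with exponents `q / 2` and `q / (q - 2)`; at `q = 2` the second would be infinite, but
  -- the power is then 1.
  rcases hq.eq_or_lt with rfl | hq
  · simp [realNorm]
  have hq0 : 0 < q := by linarith
  have hq2 : 0 < q - 2 := by linarith
  have hconj : (q / 2).HolderConjugate (q / (q - 2)) := by
    rw [Real.holderConjugate_iff]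
    refine ⟨by linarith, ?_⟩
    field_simp
    ring
  have hm : ∀ {h : Ω → ℝ} {C r : ℝ}, Measurable h → (∀ ω, h ω ∈ Set.Icc 0 C) →
      MemLp h (ENNReal.ofReal r) μ := by
    intro h C r hh hC
    refine MemLp.of_bound hh.aestronglyMeasurable C (Filter.Eventually.of_forall fun ω => ?_)
    rw [Real.norm_of_nonneg (hC ω).1]
    exact (hC ω).2
  have hgq : ∀ ω, g ω ^ (q - 2) ∈ Set.Icc 0 (B ^ (q - 2)) := fun ω =>
    rpow_mem_Icc hq2.le (hgB ω)
  have h := integral_mul_le_Lp_mul_Lq_of_nonneg (μ := μ) hconj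
    (Filter.Eventually.of_forall fun ω => (hfA ω).1)
    (Filter.Eventually.of_forall fun ω => (hgq ω).1) (hm hf hfA)
    (hm (hg.pow_const (q - 2)) hgq)
  have e1 : ∀ ω, (g ω ^ (q - 2)) ^ (q / (q - 2)) = g ω ^ q := by
    intro ω
    rw [← Real.rpow_mul (hgB ω).1]
    congr 1
    field_simp
  simp only [e1] at h
  refine h.trans_eq ?_
  unfold realNorm
  rw [← Real.rpow_mul (integral_nonneg fun ω => Real.rpow_nonneg (hgB ω).1 q)]
  congr 2
  field_simp

end Moments

/-! ### Moments of the positive and negative parts in terms of `V`. -/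

section BoundedMoments

variable {Ω 𝒳 : Type*} [MeasurableSpace Ω] [MeasurableSpace 𝒳] {μ : Measure Ω}
  [IsProbabilityMeasure μ] {n : ℕ} {X : Fin n → Ω → 𝒳}

/-- Common source of both tails: the entropy inequality with `T = φ(Z) + M`, fed into
`moment_recurrence`. -/
theorem realNorm_sq_le_of_contraction {B C m q c s v : ℝ} (hq : 2 ≤ q)
    (hX : ∀ i, Measurable (X i)) (hindep : iIndepFun X μ) {F : (Fin n → 𝒳) → ℝ}
    {G : (i : Fin n) → ({j : Fin n // j ≠ i} → 𝒳) → ℝ}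
    (hF : Measurable F) (hG : ∀ i, Measurable (G i)) (hFB : ∀ x, F x ∈ Set.Icc 0 B)
    (hGB : ∀ i x, G i x ∈ Set.Icc 0 B)
    {φ : ℝ → ℝ} (hφ : Measurable φ) (hφB : ∀ z ∈ Set.Icc 0 B, φ z ∈ Set.Icc 0 m)
    (hφL : ∀ x y, (φ x - φ y) ^ 2 ≤ (x - y) ^ 2)
    (hφZ : ∀ z, φ z ^ 2 ≤ (z - ∫ ω, varZ F X ω ∂μ) ^ 2) {M : Ω → ℝ} (hM : Measurable M)
    (hMC : ∀ ω, M ω ∈ Set.Icc 0 C)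
    (hZiM : ∀ i, ∀ᵐ ω ∂μ, φ (varZi G X i ω) ≤ φ (varZ F X ω) + M ω)
    (hs : 0 ≤ s) (hc : 1 ≤ c)
    (hconst : Real.exp (-(1 / 2)) + 1 / (2 * c) * Real.exp (s / Real.sqrt c) ≤ 1)
    (hVv : realNorm μ (varV F G X) (q / 2) ≤ v)
    (hMv : realNorm μ M q ≤ s * Real.sqrt (v / q)) :
    realNorm μ (fun ω => φ (varZ F X ω)) q ^ 2 ≤ c * q * v := by
  have hVm := measurable_varV hX hF hG
  have hVB := varV_mem_Icc (X := X) hFB hGB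
  have hYm : Measurable fun ω => φ (varZ F X ω) := hφ.comp (measurable_varZ hX hF)
  have hYB : ∀ ω, φ (varZ F X ω) ∈ Set.Icc 0 m := fun ω => hφB _ (hFB _)
  have hv : 0 ≤ v := (realNorm_nonneg hVB _).trans hVv
  have hTB : ∀ ω, φ (varZ F X ω) + M ω ∈ Set.Icc 0 (m + C) := fun ω =>
    ⟨add_nonneg (hYB ω).1 (hMC ω).1, add_le_add (hYB ω).2 (hMC ω).2⟩
  have hY0 := realNorm_nonneg (μ := μ) hYB
  refine moment_recurrence (a := fun r => realNorm μ (fun ω => φ (varZ F X ω)) r) hv hY0 hs hc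
    hconst ?_ ?_ (by linarith : (1 : ℝ) ≤ q) le_rfl
  · intro r hr1 hr2
    calc realNorm μ (fun ω => φ (varZ F X ω)) r ^ 2
        ≤ realNorm μ (fun ω => φ (varZ F X ω)) 2 ^ 2 :=
          pow_le_pow_left₀ (hY0 r) (realNorm_mono_exponent hYm hYB (by linarith) hr2) 2
      _ = ∫ ω, φ (varZ F X ω) ^ 2 ∂μ := by
          have := realNorm_rpow (μ := μ) hYB (q := 2) (by norm_num)
          simpa only [Real.rpow_two] using this
      _ ≤ ∫ ω, (varZ F X ω - ∫ ω', varZ F X ω' ∂μ) ^ 2 ∂μ := by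
          refine integral_mono_of_nonneg (Filter.Eventually.of_forall fun ω => sq_nonneg _) ?_
            (Filter.Eventually.of_forall fun ω => hφZ _)
          have hmB := integral_mem_Icc (ν := μ) (measurable_varZ hX hF)
            fun ω => hFB fun j => X j ω
          refine integrable_of_mem_Icc (A := 0) (B := B ^ 2)
            (((measurable_varZ hX hF).sub measurable_const).pow_const 2)
            fun ω => ⟨sq_nonneg _, ?_⟩
          have h1 := hFB fun j => X j ω
          have h2 := hmB.1
          have h3 := hmB.2
          exact sq_le_sq' (by unfold varZ at *; linarith [h1.1])
            (by unfold varZ at *; linarith [h1.2])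
      _ ≤ ∫ ω, varV F G X ω ∂μ := variance_le_integral_varV hX hindep hF hG hFB hGB
      _ = realNorm μ (varV F G X) 1 := by simp [realNorm]
      _ ≤ realNorm μ (varV F G X) (q / 2) :=
          realNorm_mono_exponent hVm hVB one_pos (by linarith)
      _ ≤ v := hVv
  · intro r hr hrq
    have hr0 : 0 < r := by linarith
    have hr1 : 0 < r - 1 := by linarith
    have h := integral_rpow_le_of_contraction hr hX hindep hF hG hFB hGB hφ hφB hφL
      (hYm.add hM) hTB (fun ω => by simpa using (hMC ω).1) hZiM
    rw [← realNorm_rpow hYB hr0, ← realNorm_rpow hYB hr1, ← Real.rpow_mul (hY0 _),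
      mul_div_cancel₀ _ hr1.ne'] at h
    refine h.trans ?_
    have hV0 := realNorm_nonneg (μ := μ) hVB (r / 2)
    -- As `r` decreases to below `q`, `‖M‖_r` decreases while `√(v/r)` grows, so the hypothesis at
    -- `q` suffices for the whole recurrence.
    have hMr : realNorm μ M r ≤ s * Real.sqrt (v / r) := by
      refine (realNorm_mono_exponent hM hMC hr0 hrq).trans (hMv.trans ?_)
      exact mul_le_mul_of_nonneg_left
        (Real.sqrt_le_sqrt (div_le_div_of_nonneg_left hv hr0 hrq)) hs
    have hVr : realNorm μ (varV F G X) (r / 2) ≤ v :=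
      (realNorm_mono_exponent hVm hVB (by linarith) (by linarith)).trans hVv
    have hT := (realNorm_add_le (μ := μ) hYm hYB hM hMC (by linarith : (1 : ℝ) ≤ r)).trans
      (add_le_add_right hMr _)
    have hI := integral_mul_rpow_le (μ := μ) hVm hVB (hYm.add hM) hTB hr
    have hT0 := realNorm_nonneg (μ := μ) hTB r
    refine add_le_add_right (mul_le_mul_of_nonneg_left (hI.trans ?_) (by linarith)) _
    exact mul_le_mul hVr (Real.rpow_le_rpow hT0 hT (by linarith)) (Real.rpow_nonneg hT0 _) hv

/-- `z ↦ (z - m)₊` is nondecreasing and `Zᵢ ≤ Z`, so no correction is needed: `M = 0`, `s = 0`. -/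
theorem realNorm_posPart_sq_le {B q : ℝ} (hq : 2 ≤ q)
    (hX : ∀ i, Measurable (X i)) (hindep : iIndepFun X μ) {F : (Fin n → 𝒳) → ℝ}
    {G : (i : Fin n) → ({j : Fin n // j ≠ i} → 𝒳) → ℝ}
    (hF : Measurable F) (hG : ∀ i, Measurable (G i)) (hFB : ∀ x, F x ∈ Set.Icc 0 B)
    (hGB : ∀ i x, G i x ∈ Set.Icc 0 B)
    (hZi : ∀ i, ∀ᵐ ω ∂μ, varZi G X i ω ≤ varZ F X ω) :
    realNorm μ (fun ω => max (varZ F X ω - ∫ ω', varZ F X ω' ∂μ) 0) q ^ 2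
      ≤ kappaConst * q * realNorm μ (varV F G X) (q / 2) := by
  have hm : 0 ≤ ∫ ω', varZ F X ω' ∂μ := integral_nonneg fun ω => (hFB _).1
  set m := ∫ ω', varZ F X ω' ∂μ with hm_def
  refine realNorm_sq_le_of_contraction (m := B) (C := 0) (s := 0)
    (φ := fun z => max (z - m) 0) (M := fun _ => 0) hq hX hindep hF hG hFB hGB
    (by fun_prop) ?_ ?_ ?_ measurable_const (fun ω => by simp) ?_ le_rfl kappaConst_ge_one
    kappaConst_equation.le le_rfl ?_
  · intro z hz
    exact ⟨le_max_right _ _, max_le (by linarith [hz.2]) (hz.1.trans hz.2)⟩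
  · intro x y
    refine sq_le_sq.2 ((abs_max_sub_max_le_abs _ _ _).trans_eq ?_)
    congr 1
    ring
  · intro z
    rw [← hm_def]
    have := abs_max_sub_max_le_abs (z - m) 0 0
    simp only [max_self, sub_zero] at this
    exact sq_le_sq.2 this
  · intro i
    filter_upwards [hZi i] with ω hω
    rw [add_zero]
    exact max_le_max (by linarith) le_rfl
  · have : (0 : ℝ) < q := by linarith
    simp [realNorm, Real.zero_rpow this.ne', Real.zero_rpow (inv_ne_zero this.ne')]

/-- `z ↦ (m - z)₊` may grow by up to `M` when `Z` is replaced by `Zᵢ`. The second entry of the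
maximum `v` makes `‖M‖_q ≤ √(v/q)`, so `s = 1`. -/
theorem realNorm_negPart_sq_le {B C q : ℝ} (hq : 2 ≤ q)
    (hX : ∀ i, Measurable (X i)) (hindep : iIndepFun X μ) {F : (Fin n → 𝒳) → ℝ}
    {G : (i : Fin n) → ({j : Fin n // j ≠ i} → 𝒳) → ℝ}
    (hF : Measurable F) (hG : ∀ i, Measurable (G i)) (hFB : ∀ x, F x ∈ Set.Icc 0 B)
    (hGB : ∀ i x, G i x ∈ Set.Icc 0 B) {M : Ω → ℝ} (hM : Measurable M)
    (hMC : ∀ ω, M ω ∈ Set.Icc 0 C)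
    (hZiM : ∀ i, ∀ᵐ ω ∂μ, varZ F X ω - varZi G X i ω ≤ M ω) :
    realNorm μ (fun ω => max ((∫ ω', varZ F X ω' ∂μ) - varZ F X ω) 0) q ^ 2
      ≤ cTwo * q * max (realNorm μ (varV F G X) (q / 2)) (q * realNorm μ M q ^ 2) := by
  have hmB := integral_mem_Icc (ν := μ) (measurable_varZ hX hF) fun ω => hFB fun j => X j ω
  set m := ∫ ω', varZ F X ω' ∂μ with hm_def
  have hq0 : 0 < q := by linarith
  refine realNorm_sq_le_of_contraction (m := B) (s := 1)
    (φ := fun z => max (m - z) 0) hq hX hindep hF hG hFB hGB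
    (by fun_prop) ?_ ?_ ?_ hM hMC ?_ zero_le_one cTwo_ge_one
    cTwo_equation.le (le_max_left _ _) ?_
  · intro z hz
    exact ⟨le_max_right _ _, max_le (by linarith [hz.1, hmB.2]) (hz.1.trans hz.2)⟩
  · intro x y
    refine sq_le_sq.2 ((abs_max_sub_max_le_abs _ _ _).trans_eq ?_)
    rw [abs_sub_comm x y]
    congr 1
    ring
  · intro z
    rw [← hm_def]
    have := abs_max_sub_max_le_abs (m - z) 0 0
    simp only [max_self, sub_zero] at this
    rw [← neg_sub m z, neg_sq]
    exact sq_le_sq.2 this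
  · intro i
    filter_upwards [hZiM i] with ω hω
    have h1 := le_max_left (m - varZ F X ω) 0
    have h2 := le_max_right (m - varZ F X ω) 0
    exact max_le (by linarith) (add_nonneg h2 (hMC ω).1)
  · rw [one_mul]
    refine Real.le_sqrt_of_sq_le ?_
    rw [le_div_iff₀ hq0, mul_comm]
    exact le_max_right _ _

end BoundedMoments

/-! ### Two elementary quadratic inequalities. -/

theorem le_of_le_add_of_sq_le {a d e k θ : ℝ} (hk : 0 ≤ k) (ha : 0 ≤ a)
    (hθ : 0 < θ) (hθ1 : θ ≤ 1) (had : a ≤ e + d) (hd2 : d ^ 2 ≤ k * a) :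
    a ≤ (1 + θ) * e + 1 / 2 * (1 + 1 / θ) * k := by
  -- AM-GM for `√(k a)`, weighted so that absorbing the `a` term leaves the factor `1 + θ` on `e`.
  -- The resulting `(1 + θ)² / (4θ)` is at most `(1 + 1/θ) / 2` because `θ ≤ 1`.
  have h1 : d ≤ θ / (1 + θ) * a + (1 + θ) / (4 * θ) * k := by
    refine le_of_sq_le_sq ?_ (by positivity)
    refine hd2.trans ?_
    have : (θ / (1 + θ) * a + (1 + θ) / (4 * θ) * k) ^ 2 - k * a / 1
        = (θ / (1 + θ) * a - (1 + θ) / (4 * θ) * k) ^ 2 := by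
      field_simp
      ring
    nlinarith [sq_nonneg (θ / (1 + θ) * a - (1 + θ) / (4 * θ) * k)]
  have h2 : a * (1 / (1 + θ)) ≤ e + (1 + θ) / (4 * θ) * k := by
    have : a * (1 / (1 + θ)) = a - θ / (1 + θ) * a := by field_simp; ring
    linarith
  have h3 : a ≤ (1 + θ) * (e + (1 + θ) / (4 * θ) * k) := by
    have := mul_le_mul_of_nonneg_left h2 (by linarith : 0 ≤ 1 + θ)
    have e1 : (1 + θ) * (a * (1 / (1 + θ))) = a := by field_simp
    linarith
  have h4 : (1 + θ) * ((1 + θ) / (4 * θ) * k) ≤ 1 / 2 * (1 + 1 / θ) * k := by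
    rw [← mul_assoc]
    refine mul_le_mul_of_nonneg_right ?_ hk
    have e1 : 1 / 2 * (1 + 1 / θ) - (1 + θ) * ((1 + θ) / (4 * θ))
        = (1 + θ) * (1 - θ) / (4 * θ) := by
      field_simp
      ring
    have : 0 ≤ (1 + θ) * (1 - θ) / (4 * θ) :=
      div_nonneg (mul_nonneg (by linarith) (by linarith)) (by linarith)
    linarith
  linarith

/-- Otherwise, with `r = √(2ke)`, `d (d - k) > r (r + k) ≥ 2ke`, against `d (d - k) ≤ ke`. -/
theorem le_sqrt_add_of_sq_le {d e k : ℝ} (hk : 0 ≤ k) (he : 0 ≤ e)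
    (h : d ^ 2 ≤ k * (e + d)) : d ≤ Real.sqrt (2 * k * e) + k := by
  by_contra! hlt
  have hr0 := Real.sqrt_nonneg (2 * k * e)
  have hr := Real.sq_sqrt (show 0 ≤ 2 * k * e by positivity)
  set r := Real.sqrt (2 * k * e)
  nlinarith [mul_nonneg hk he, mul_nonneg hr0 hk]

/-! ### Passage to norms valued in `[0, ∞]`. -/

section ENNRealForm

variable {Ω : Type*} [MeasurableSpace Ω] {μ : Measure Ω}

theorem eLpNorm_ofReal_comp {f : Ω → ℝ} (hf : ∀ᵐ ω ∂μ, 0 ≤ f ω) (p : ℝ≥0∞) :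
    eLpNorm (fun ω => ENNReal.ofReal (f ω)) p μ = eLpNorm f p μ := by
  refine eLpNorm_congr_enorm_ae ?_
  filter_upwards [hf] with ω hω
  rw [Real.enorm_of_nonneg hω, enorm_eq_self]

theorem eLpNorm_mul_le_of_nonneg {f g h : Ω → ℝ} {q : ℝ} (hq : 0 < q) (hf : Measurable f)
    (hg : Measurable g) (hh : ∀ ω, 0 ≤ h ω) (hle : ∀ᵐ ω ∂μ, h ω ≤ f ω * g ω) :
    eLpNorm h (ENNReal.ofReal (q / 2)) μ
      ≤ eLpNorm f (ENNReal.ofReal q) μ * eLpNorm g (ENNReal.ofReal q) μ := by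
  have htriple : ENNReal.HolderTriple (ENNReal.ofReal q) (ENNReal.ofReal q)
      (ENNReal.ofReal (q / 2)) := by
    constructor
    rw [← ENNReal.ofReal_inv_of_pos hq, ← ENNReal.ofReal_inv_of_pos (by linarith),
      ← ENNReal.ofReal_add (by positivity) (by positivity)]
    congr 1
    field_simp
    norm_num
  refine le_trans (eLpNorm_mono_ae ?_)
    (eLpNorm_smul_le_mul_eLpNorm (r := ENNReal.ofReal (q / 2)) hg.aestronglyMeasurable
      hf.aestronglyMeasurable)
  filter_upwards [hle] with ω hω
  rw [Real.norm_of_nonneg (hh ω)]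
  exact hω.trans (le_abs_self _)

/-- Fatou's lemma for the `q`-th powers; the limit may take the value `∞`. -/
theorem eLpNorm_le_of_tendsto {f : ℕ → Ω → ℝ≥0∞} {g : Ω → ℝ≥0∞} {q : ℝ} {R : ℝ≥0∞}
    (hq : 0 < q) (hf : ∀ N, Measurable (f N))
    (hlim : ∀ᵐ ω ∂μ, Filter.Tendsto (fun N => f N ω) Filter.atTop (nhds (g ω)))
    (hR : ∀ N, eLpNorm (f N) (ENNReal.ofReal q) μ ≤ R) :
    eLpNorm g (ENNReal.ofReal q) μ ≤ R := by
  have hq' : ENNReal.ofReal q ≠ 0 := by simpa using hq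
  have key : ∀ h : Ω → ℝ≥0∞, eLpNorm h (ENNReal.ofReal q) μ ≤ R ↔ ∫⁻ ω, h ω ^ q ∂μ ≤ R ^ q := by
    intro h
    rw [eLpNorm_eq_lintegral_rpow_enorm_toReal hq' ENNReal.ofReal_ne_top,
      ENNReal.toReal_ofReal hq.le, one_div, ENNReal.rpow_inv_le_iff hq]
    simp only [enorm_eq_self]
  rw [key]
  have hlim' : ∀ᵐ ω ∂μ, g ω ^ q = Filter.liminf (fun N => f N ω ^ q) Filter.atTop := by
    filter_upwards [hlim] with ω hω
    exact ((ENNReal.continuous_rpow_const.tendsto _).comp hω).liminf_eq.symm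
  rw [lintegral_congr_ae hlim']
  refine (lintegral_liminf_le fun N => (hf N).pow_const q).trans ?_
  refine Filter.liminf_le_of_le (by isBoundedDefault) fun b hb => ?_
  obtain ⟨N, hN⟩ := hb.exists
  exact hN.trans ((key _).1 (hR N))

variable [IsProbabilityMeasure μ] {Z : Ω → ℝ} {B q : ℝ}

theorem extMean_eq_ofReal_integral (hZ : Measurable Z) (hZB : ∀ ω, Z ω ∈ Set.Icc 0 B) :
    extMean μ Z = ENNReal.ofReal (∫ ω, Z ω ∂μ) :=
  (ofReal_integral_eq_lintegral_ofReal (integrable_of_mem_Icc hZ hZB)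
    (Filter.Eventually.of_forall fun ω => (hZB ω).1)).symm

theorem posPart_sub_mem_Icc {m z : ℝ} (hm : m ∈ Set.Icc 0 B) (hz : z ∈ Set.Icc 0 B) :
    max (z - m) 0 ∈ Set.Icc 0 B :=
  ⟨le_max_right _ _, max_le (by linarith [hz.2, hm.1]) (hz.1.trans hz.2)⟩

theorem eLpNorm_devPos_eq (hq : 0 < q) (hZ : Measurable Z) (hZB : ∀ ω, Z ω ∈ Set.Icc 0 B) :
    eLpNorm (devPos μ Z) (ENNReal.ofReal q) μ
      = ENNReal.ofReal (realNorm μ (fun ω => max (Z ω - ∫ ω', Z ω' ∂μ) 0) q) := by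
  have hm := integral_mem_Icc (ν := μ) hZ hZB
  rw [← eLpNorm_eq_realNorm (B := B) (by fun_prop) (fun ω => posPart_sub_mem_Icc hm (hZB ω)) hq,
    ← eLpNorm_ofReal_comp (Filter.Eventually.of_forall fun ω => le_max_right _ _)]
  congr 1
  funext ω
  rw [devPos, extMean_eq_ofReal_integral hZ hZB, ← ENNReal.ofReal_sub _ hm.1]
  simp [ENNReal.ofReal_max]

theorem eLpNorm_devNeg_eq (hq : 0 < q) (hZ : Measurable Z) (hZB : ∀ ω, Z ω ∈ Set.Icc 0 B) :
    eLpNorm (devNeg μ Z) (ENNReal.ofReal q) μ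
      = ENNReal.ofReal (realNorm μ (fun ω => max ((∫ ω', Z ω' ∂μ) - Z ω) 0) q) := by
  have hm := integral_mem_Icc (ν := μ) hZ hZB
  rw [← eLpNorm_eq_realNorm (B := B) (by fun_prop) (fun ω => posPart_sub_mem_Icc (hZB ω) hm) hq,
    ← eLpNorm_ofReal_comp (Filter.Eventually.of_forall fun ω => le_max_right _ _)]
  congr 1
  funext ω
  rw [devNeg, extMean_eq_ofReal_integral hZ hZB, ← ENNReal.ofReal_sub _ (hZB ω).1]
  simp [ENNReal.ofReal_max]

/-- Minkowski applied to `Z ≤ E Z + (Z - E Z)₊`. -/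
theorem realNorm_le_integral_add (hq : 1 ≤ q) (hZ : Measurable Z)
    (hZB : ∀ ω, Z ω ∈ Set.Icc 0 B) :
    realNorm μ Z q
      ≤ ∫ ω, Z ω ∂μ + realNorm μ (fun ω => max (Z ω - ∫ ω', Z ω' ∂μ) 0) q := by
  have hm := integral_mem_Icc (ν := μ) hZ hZB
  set m := ∫ ω', Z ω' ∂μ
  have hq0 : 0 < q := by linarith
  have hP : ∀ ω, max (Z ω - m) 0 ∈ Set.Icc 0 B := fun ω => posPart_sub_mem_Icc hm (hZB ω)
  have hsum : ∀ ω, m + max (Z ω - m) 0 ∈ Set.Icc 0 (B + B) := fun ω =>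
    ⟨add_nonneg hm.1 (hP ω).1, add_le_add hm.2 (hP ω).2⟩
  have h1 := realNorm_add_le (μ := μ) (f := fun _ => m) (g := fun ω => max (Z ω - m) 0)
    measurable_const (fun _ => hm) (by fun_prop) hP hq
  have h2 : realNorm μ (fun _ : Ω => m) q = m := by
    simp only [realNorm, integral_const, probReal_univ, one_smul]
    rw [← Real.rpow_mul hm.1, mul_one_div_cancel hq0.ne', Real.rpow_one]
  have h3 : realNorm μ Z q ≤ realNorm μ (fun ω => m + max (Z ω - m) 0) q := by
    have h := eLpNorm_mono (μ := μ) (p := ENNReal.ofReal q) (f := Z)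
      (g := fun ω => m + max (Z ω - m) 0) (by
        intro ω
        rw [Real.norm_of_nonneg (hZB ω).1, Real.norm_of_nonneg (hsum ω).1]
        linarith [le_max_left (Z ω - m) 0])
    rw [eLpNorm_eq_realNorm hZ hZB hq0, eLpNorm_eq_realNorm (by fun_prop) hsum hq0] at h
    exact (ENNReal.ofReal_le_ofReal_iff (realNorm_nonneg hsum q)).1 h
  linarith

end ENNRealForm

/-! ### The three bounds for bounded variables. -/

section BoundedCorollary

variable {Ω 𝒳 : Type*} [MeasurableSpace Ω] [MeasurableSpace 𝒳] {μ : Measure Ω}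
  [IsProbabilityMeasure μ] {n : ℕ} {X : Fin n → Ω → 𝒳} {F : (Fin n → 𝒳) → ℝ}
  {G : (i : Fin n) → ({j : Fin n // j ≠ i} → 𝒳) → ℝ} {W : Ω → ℝ} {B q : ℝ}

theorem realNorm_varV_le (hq : 2 ≤ q) (hX : ∀ i, Measurable (X i)) (hF : Measurable F)
    (hG : ∀ i, Measurable (G i)) (hFB : ∀ x, F x ∈ Set.Icc 0 B)
    (hGB : ∀ i x, G i x ∈ Set.Icc 0 B) (hW : Measurable W)
    (hV : ∀ᵐ ω ∂μ, varV F G X ω ≤ W ω * varZ F X ω)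
    (hWtop : eLpNorm W (ENNReal.ofReal q) μ ≠ ∞) :
    realNorm μ (varV F G X) (q / 2)
      ≤ (eLpNorm W (ENNReal.ofReal q) μ).toReal * realNorm μ (varZ F X) q := by
  have hq0 : 0 < q := by linarith
  have hZB : ∀ ω, varZ F X ω ∈ Set.Icc 0 B := fun ω => hFB _
  have hVB := varV_mem_Icc (X := X) hFB hGB
  have h := eLpNorm_mul_le_of_nonneg hq0 hW (measurable_varZ hX hF) (fun ω => (hVB ω).1) hV
  rw [eLpNorm_eq_realNorm (measurable_varZ hX hF) hZB hq0,
    eLpNorm_eq_realNorm (measurable_varV hX hF hG) hVB (by linarith),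
    ← ENNReal.ofReal_toReal hWtop, ← ENNReal.ofReal_mul ENNReal.toReal_nonneg] at h
  exact (ENNReal.ofReal_le_ofReal_iff
    (mul_nonneg ENNReal.toReal_nonneg (realNorm_nonneg hZB q))).1 h

/-- The bound behind both upper-tail estimates. -/
theorem realNorm_posPart_sq_le_mul (hq : 2 ≤ q) (hX : ∀ i, Measurable (X i))
    (hindep : iIndepFun X μ) (hF : Measurable F) (hG : ∀ i, Measurable (G i))
    (hFB : ∀ x, F x ∈ Set.Icc 0 B) (hGB : ∀ i x, G i x ∈ Set.Icc 0 B)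
    (hZi : ∀ i, ∀ᵐ ω ∂μ, varZi G X i ω ≤ varZ F X ω) (hW : Measurable W)
    (hV : ∀ᵐ ω ∂μ, varV F G X ω ≤ W ω * varZ F X ω)
    (hWtop : eLpNorm W (ENNReal.ofReal q) μ ≠ ∞) :
    realNorm μ (fun ω => max (varZ F X ω - ∫ ω', varZ F X ω' ∂μ) 0) q ^ 2
      ≤ kappaConst * q * (eLpNorm W (ENNReal.ofReal q) μ).toReal * realNorm μ (varZ F X) q := by
  have hk := kappaConst_ge_one
  refine (realNorm_posPart_sq_le hq hX hindep hF hG hFB hGB hZi).trans ?_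
  rw [mul_assoc (kappaConst * q)]
  exact mul_le_mul_of_nonneg_left (realNorm_varV_le hq hX hF hG hFB hGB hW hV hWtop)
    (by positivity)

theorem realNorm_varZ_le {θ : ℝ} (hθ : 0 < θ) (hθ1 : θ ≤ 1) (hq : 2 ≤ q)
    (hX : ∀ i, Measurable (X i))
    (hindep : iIndepFun X μ) (hF : Measurable F) (hG : ∀ i, Measurable (G i))
    (hFB : ∀ x, F x ∈ Set.Icc 0 B) (hGB : ∀ i x, G i x ∈ Set.Icc 0 B)
    (hZi : ∀ i, ∀ᵐ ω ∂μ, varZi G X i ω ≤ varZ F X ω) (hW : Measurable W)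
    (hV : ∀ᵐ ω ∂μ, varV F G X ω ≤ W ω * varZ F X ω)
    (hWtop : eLpNorm W (ENNReal.ofReal q) μ ≠ ∞) :
    realNorm μ (varZ F X) q ≤ (1 + θ) * ∫ ω, varZ F X ω ∂μ
      + kappaConst / 2 * (1 + 1 / θ) * q * (eLpNorm W (ENNReal.ofReal q) μ).toReal := by
  have hk := kappaConst_ge_one
  have hw : 0 ≤ (eLpNorm W (ENNReal.ofReal q) μ).toReal := ENNReal.toReal_nonneg
  have hZB : ∀ ω, varZ F X ω ∈ Set.Icc 0 B := fun ω => hFB _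
  have h := le_of_le_add_of_sq_le
    (k := kappaConst * q * (eLpNorm W (ENNReal.ofReal q) μ).toReal)
    (by positivity)
    (realNorm_nonneg hZB q) hθ hθ1
    (realNorm_le_integral_add (by linarith) (measurable_varZ hX hF) hZB)
    (realNorm_posPart_sq_le_mul hq hX hindep hF hG hFB hGB hZi hW hV hWtop)
  refine h.trans_eq ?_
  ring

theorem eLpNorm_varZ_le_of_bounded {θ : ℝ} (hθ : 0 < θ) (hθ1 : θ ≤ 1) (hq : 2 ≤ q)
    (hX : ∀ i, Measurable (X i))
    (hindep : iIndepFun X μ) (hF : Measurable F) (hG : ∀ i, Measurable (G i))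
    (hFB : ∀ x, F x ∈ Set.Icc 0 B) (hGB : ∀ i x, G i x ∈ Set.Icc 0 B)
    (hZi : ∀ i, ∀ᵐ ω ∂μ, varZi G X i ω ≤ varZ F X ω) (hW : Measurable W)
    (hV : ∀ᵐ ω ∂μ, varV F G X ω ≤ W ω * varZ F X ω) :
    eLpNorm (varZ F X) (ENNReal.ofReal q) μ ≤
      ENNReal.ofReal (1 + θ) * extMean μ (varZ F X) +
        ENNReal.ofReal (kappaConst / 2 * (1 + 1 / θ) * q) *
          eLpNorm W (ENNReal.ofReal q) μ := by
  have hk := kappaConst_ge_one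
  have hZB : ∀ ω, varZ F X ω ∈ Set.Icc 0 B := fun ω => hFB _
  have hZm := measurable_varZ hX hF
  have hc : 0 < kappaConst / 2 * (1 + 1 / θ) * q := by positivity
  by_cases hWtop : eLpNorm W (ENNReal.ofReal q) μ = ∞
  · rw [hWtop, ENNReal.mul_top (by simpa using hc), add_top]
    exact le_top
  have h := realNorm_varZ_le hθ hθ1 hq hX hindep hF hG hFB hGB hZi hW hV hWtop
  have hm := (integral_mem_Icc (ν := μ) hZm hZB).1
  rw [eLpNorm_eq_realNorm hZm hZB (by linarith), extMean_eq_ofReal_integral hZm hZB,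
    ← ENNReal.ofReal_toReal hWtop, ← ENNReal.ofReal_mul (by linarith),
    ← ENNReal.ofReal_mul hc.le, ← ENNReal.ofReal_add (by positivity) (by positivity)]
  exact ENNReal.ofReal_le_ofReal h

theorem eLpNorm_devPos_le_of_bounded (hq : 2 ≤ q) (hX : ∀ i, Measurable (X i))
    (hindep : iIndepFun X μ) (hF : Measurable F) (hG : ∀ i, Measurable (G i))
    (hFB : ∀ x, F x ∈ Set.Icc 0 B) (hGB : ∀ i x, G i x ∈ Set.Icc 0 B)
    (hZi : ∀ i, ∀ᵐ ω ∂μ, varZi G X i ω ≤ varZ F X ω) (hW : Measurable W)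
    (hV : ∀ᵐ ω ∂μ, varV F G X ω ≤ W ω * varZ F X ω) :
    eLpNorm (devPos μ (varZ F X)) (ENNReal.ofReal q) μ ≤
      (ENNReal.ofReal (2 * kappaConst * q) * eLpNorm W (ENNReal.ofReal q) μ *
          extMean μ (varZ F X)) ^ (1 / 2 : ℝ) +
        ENNReal.ofReal (kappaConst * q) * eLpNorm W (ENNReal.ofReal q) μ := by
  have hk := kappaConst_ge_one
  have hZB : ∀ ω, varZ F X ω ∈ Set.Icc 0 B := fun ω => hFB _
  have hZm := measurable_varZ hX hF
  have hc : 0 < kappaConst * q := by positivity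
  -- When `‖W‖_q = ∞` the product under the root may be `∞ · 0 = 0`, but the linear term is
  -- infinite.
  by_cases hWtop : eLpNorm W (ENNReal.ofReal q) μ = ∞
  · rw [hWtop, ENNReal.mul_top (a := ENNReal.ofReal (kappaConst * q)) (by simpa using hc),
      add_top]
    exact le_top
  have h := realNorm_posPart_sq_le_mul hq hX hindep hF hG hFB hGB hZi hW hV hWtop
  have hm := (integral_mem_Icc (ν := μ) hZm hZB).1
  have hadd := realNorm_le_integral_add (μ := μ) (by linarith : (1 : ℝ) ≤ q) hZm hZB
  rw [eLpNorm_devPos_eq (by linarith) hZm hZB, extMean_eq_ofReal_integral hZm hZB,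
    ← ENNReal.ofReal_toReal hWtop]
  have hw : 0 ≤ (eLpNorm W (ENNReal.ofReal q) μ).toReal := ENNReal.toReal_nonneg
  set w := (eLpNorm W (ENNReal.ofReal q) μ).toReal
  have hfin := le_sqrt_add_of_sq_le (k := kappaConst * q * w) (by positivity) hm
    (h.trans (mul_le_mul_of_nonneg_left hadd (by positivity)))
  rw [← ENNReal.ofReal_mul (by positivity), ← ENNReal.ofReal_mul (by positivity),
    ENNReal.ofReal_rpow_of_nonneg (by positivity) (by norm_num), ← Real.sqrt_eq_rpow,
    ← ENNReal.ofReal_mul hc.le, ← ENNReal.ofReal_add (Real.sqrt_nonneg _) (by positivity)]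
  refine ENNReal.ofReal_le_ofReal (hfin.trans_eq ?_)
  congr 3
  ring

theorem eLpNorm_devNeg_le_of_bounded {C : ℝ} (hq : 2 ≤ q) (hX : ∀ i, Measurable (X i))
    (hindep : iIndepFun X μ) (hF : Measurable F) (hG : ∀ i, Measurable (G i))
    (hFB : ∀ x, F x ∈ Set.Icc 0 B) (hGB : ∀ i x, G i x ∈ Set.Icc 0 B)
    (hZi : ∀ i, ∀ᵐ ω ∂μ, varZi G X i ω ≤ varZ F X ω) (hW : Measurable W)
    (hV : ∀ᵐ ω ∂μ, varV F G X ω ≤ W ω * varZ F X ω) {M : Ω → ℝ} (hM : Measurable M)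
    (hMC : ∀ ω, M ω ∈ Set.Icc 0 C)
    (hZiM : ∀ i, ∀ᵐ ω ∂μ, varZ F X ω - varZi G X i ω ≤ M ω) :
    eLpNorm (devNeg μ (varZ F X)) (ENNReal.ofReal q) μ ≤
      (ENNReal.ofReal (cTwo * q) *
        max
          (eLpNorm W (ENNReal.ofReal q) μ *
            (2 * extMean μ (varZ F X) +
              ENNReal.ofReal (2 * q) * eLpNorm W (ENNReal.ofReal q) μ))
          (ENNReal.ofReal q * eLpNorm M (ENNReal.ofReal q) μ ^ 2)) ^ (1 / 2 : ℝ) := by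
  have hc2 := cTwo_pos
  have hq0 : 0 < q := by linarith
  have hZB : ∀ ω, varZ F X ω ∈ Set.Icc 0 B := fun ω => hFB _
  have hZm := measurable_varZ hX hF
  have hc : 0 < cTwo * q := by positivity
  rw [one_div, ENNReal.le_rpow_inv_iff (by norm_num)]
  by_cases hWtop : eLpNorm W (ENNReal.ofReal q) μ = ∞
  · rw [hWtop, ENNReal.mul_top (a := ENNReal.ofReal (2 * q)) (by simpa using hq0), add_top,
      ENNReal.top_mul_top, max_eq_left le_top, ENNReal.mul_top (by simpa using hc)]
    exact le_top
  have h := realNorm_negPart_sq_le hq hX hindep hF hG hFB hGB hM hMC hZiM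
  have hm := (integral_mem_Icc (ν := μ) hZm hZB).1
  have hV' := realNorm_varV_le hq hX hF hG hFB hGB hW hV hWtop
  have ha := realNorm_varZ_le one_pos le_rfl hq hX hindep hF hG hFB hGB hZi hW hV hWtop
  have hM0 := realNorm_nonneg (μ := μ) hMC q
  rw [eLpNorm_devNeg_eq hq0 hZm hZB, extMean_eq_ofReal_integral hZm hZB,
    ← ENNReal.ofReal_toReal hWtop, eLpNorm_eq_realNorm hM hMC hq0]
  have hw : 0 ≤ (eLpNorm W (ENNReal.ofReal q) μ).toReal := ENNReal.toReal_nonneg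
  set w := (eLpNorm W (ENNReal.ofReal q) μ).toReal
  set m := ∫ ω, varZ F X ω ∂μ
  have hVle : realNorm μ (varV F G X) (q / 2) ≤ w * (2 * m + 2 * q * w) := by
    refine hV'.trans (mul_le_mul_of_nonneg_left (ha.trans ?_) hw)
    -- `θ = 1` gives `‖Z‖_q ≤ 2 E Z + κ q ‖W‖_q`, and `κ ≤ 2` produces the stated `2q`.
    have hk := mul_le_mul_of_nonneg_right kappaConst_le_two (mul_nonneg hq0.le hw)
    linarith
  have hD : 0 ≤ realNorm μ (fun ω => max (m - varZ F X ω) 0) q :=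
    realNorm_nonneg (fun ω => posPart_sub_mem_Icc (hZB ω) (integral_mem_Icc hZm hZB)) q
  rw [show (2 : ℝ≥0∞) = ENNReal.ofReal 2 by simp, ← ENNReal.ofReal_mul (by norm_num),
    ← ENNReal.ofReal_mul (by positivity), ← ENNReal.ofReal_add (by positivity) (by positivity),
    ← ENNReal.ofReal_mul hw, ← ENNReal.ofReal_pow hM0, ← ENNReal.ofReal_mul hq0.le,
    ← ENNReal.ofReal_max, ← ENNReal.ofReal_mul hc.le, ENNReal.rpow_two, ← ENNReal.ofReal_pow hD]
  refine ENNReal.ofReal_le_ofReal (h.trans ?_)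
  exact mul_le_mul_of_nonneg_left (max_le_max hVle le_rfl) hc.le

end BoundedCorollary

/-! ### Truncation and its compatibility with `V ≤ W Z`. -/

section Truncation

/-- Truncation of a real number to `[0, N]`. -/
def truncate (N : ℕ) (z : ℝ) : ℝ := max 0 (min z N)

theorem measurable_truncate (N : ℕ) : Measurable (truncate N) :=
  measurable_const.max (measurable_id.min measurable_const)

theorem truncate_mem_Icc (N : ℕ) (z : ℝ) : truncate N z ∈ Set.Icc (0 : ℝ) N :=
  ⟨le_max_left _ _, max_le N.cast_nonneg (min_le_right _ _)⟩

theorem truncate_mono (N : ℕ) : Monotone (truncate N) := fun _ _ h =>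
  max_le_max le_rfl (min_le_min h le_rfl)

theorem truncate_mono_left (z : ℝ) : Monotone fun N => truncate N z := fun _ _ h =>
  max_le_max le_rfl (min_le_min le_rfl (by exact_mod_cast h))

theorem truncate_le {N : ℕ} {z : ℝ} (hz : 0 ≤ z) : truncate N z ≤ z :=
  max_le hz (min_le_left _ _)

theorem truncate_eq_self {N : ℕ} {z : ℝ} (hz : 0 ≤ z) (hN : z ≤ N) : truncate N z = z := by
  rw [truncate, min_eq_left hN, max_eq_right hz]

theorem truncate_sub_le {N : ℕ} {y z : ℝ} (h : y ≤ z) : truncate N z - truncate N y ≤ z - y := by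
  unfold truncate
  rcases min_cases z (N : ℝ) with h1 | h1 <;> rcases min_cases y (N : ℝ) with h2 | h2 <;>
    rcases max_cases 0 (min z (N : ℝ)) with h3 | h3 <;>
    rcases max_cases 0 (min y (N : ℝ)) with h4 | h4 <;> linarith

/-- For positive arguments this says that `truncate N x / x` is nonincreasing in `x`. -/
theorem truncate_sub_mul_le {N : ℕ} {y z : ℝ} (hz : 0 ≤ z) (h : y ≤ z) :
    (truncate N z - truncate N y) * z ≤ truncate N z * (z - y) := by
  suffices truncate N z * y ≤ truncate N y * z by linarith
  have hN : (0 : ℝ) ≤ N := N.cast_nonneg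
  obtain ⟨hz0, -⟩ := truncate_mem_Icc N z
  rcases le_total y 0 with hy | hy
  · exact (mul_nonpos_of_nonneg_of_nonpos hz0 hy).trans
      (mul_nonneg (truncate_mem_Icc N y).1 hz)
  rcases le_total y N with hyN | hyN
  · rw [truncate_eq_self hy hyN, mul_comm]
    exact mul_le_mul_of_nonneg_left (truncate_le hz) hy
  · have e1 : truncate N y = N := by rw [truncate, min_eq_right hyN, max_eq_right hN]
    rw [e1]
    exact mul_le_mul (truncate_mem_Icc N z).2 h hy hN

theorem truncate_sub_sq_mul_le {N : ℕ} {y z : ℝ} (hz : 0 ≤ z) (h : y ≤ z) :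
    (truncate N z - truncate N y) ^ 2 * z ≤ truncate N z * (z - y) ^ 2 := by
  have hδ : 0 ≤ truncate N z - truncate N y := sub_nonneg.2 (truncate_mono N h)
  calc (truncate N z - truncate N y) ^ 2 * z
      = (truncate N z - truncate N y) * ((truncate N z - truncate N y) * z) := by ring
    _ ≤ (z - y) * (truncate N z * (z - y)) :=
        mul_le_mul (truncate_sub_le h) (truncate_sub_mul_le hz h) (mul_nonneg hδ hz)
          (by linarith)
    _ = _ := by ring

/-- One factor of each squared difference shrinks by the 1-Lipschitz property, the other at least by
the ratio `truncate N z / z`. Summing and dividing by `z` keeps the same `w`; at `z = 0` all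
truncations vanish. -/
theorem sum_truncate_sub_sq_le {ι : Type*} [Fintype ι] {N : ℕ} {y : ι → ℝ} {z w : ℝ}
    (hz : 0 ≤ z) (hy : ∀ i, y i ≤ z) (h : ∑ i, (z - y i) ^ 2 ≤ w * z) :
    ∑ i, (truncate N z - truncate N (y i)) ^ 2 ≤ w * truncate N z := by
  rcases hz.eq_or_lt with rfl | hz'
  · have e0 : truncate N 0 = 0 := truncate_eq_self le_rfl N.cast_nonneg
    have e : ∀ i, truncate N (y i) = 0 := fun i =>
      le_antisymm (e0 ▸ truncate_mono N (hy i)) (truncate_mem_Icc N _).1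
    simp [e0, e]
  · refine le_of_mul_le_mul_right ?_ hz'
    calc (∑ i, (truncate N z - truncate N (y i)) ^ 2) * z
        ≤ ∑ i, truncate N z * (z - y i) ^ 2 := by
          rw [Finset.sum_mul]
          exact Finset.sum_le_sum fun i _ => truncate_sub_sq_mul_le hz (hy i)
      _ = truncate N z * ∑ i, (z - y i) ^ 2 := by rw [Finset.mul_sum]
      _ ≤ truncate N z * (w * z) :=
          mul_le_mul_of_nonneg_left h (truncate_mem_Icc N z).1
      _ = _ := by ring

theorem tendsto_ofReal_truncate {z : ℝ} (hz : 0 ≤ z) :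
    Filter.Tendsto (fun N => ENNReal.ofReal (truncate N z)) Filter.atTop
      (nhds (ENNReal.ofReal z)) := by
  obtain ⟨k, hk⟩ := exists_nat_ge z
  refine tendsto_const_nhds.congr' ?_
  filter_upwards [Filter.eventually_ge_atTop k] with N hN
  rw [truncate_eq_self hz (hk.trans (by exact_mod_cast hN))]

variable {Ω : Type*} [MeasurableSpace Ω] {μ : Measure Ω} {Z : Ω → ℝ}

theorem extMean_truncate_le (hZ0 : ∀ᵐ ω ∂μ, 0 ≤ Z ω) (N : ℕ) :
    extMean μ (fun ω => truncate N (Z ω)) ≤ extMean μ Z := by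
  refine lintegral_mono_ae ?_
  filter_upwards [hZ0] with ω hω using ENNReal.ofReal_le_ofReal (truncate_le hω)

theorem tendsto_extMean_truncate (hZ : Measurable Z) (hZ0 : ∀ᵐ ω ∂μ, 0 ≤ Z ω) :
    Filter.Tendsto (fun N => extMean μ fun ω => truncate N (Z ω)) Filter.atTop
      (nhds (extMean μ Z)) := by
  refine lintegral_tendsto_of_tendsto_of_monotone
    (fun N => ((measurable_truncate N).comp hZ).ennreal_ofReal.aemeasurable) ?_ ?_
  · exact Filter.Eventually.of_forall fun ω _ _ h =>
      ENNReal.ofReal_le_ofReal (truncate_mono_left _ h)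
  · filter_upwards [hZ0] with ω hω using tendsto_ofReal_truncate hω

end Truncation

/-! ### The general case, by letting the truncation level tend to infinity. -/

theorem corollary3 {Ω 𝒳 : Type*} [MeasurableSpace Ω] [MeasurableSpace 𝒳]
    (μ : Measure Ω) [IsProbabilityMeasure μ] (n : ℕ)
    (X : Fin n → Ω → 𝒳) (hX : ∀ i, Measurable (X i)) (hindep : iIndepFun X μ)
    (F : (Fin n → 𝒳) → ℝ) (hF : Measurable F)
    (G : (i : Fin n) → ({j : Fin n // j ≠ i} → 𝒳) → ℝ) (hG : ∀ i, Measurable (G i))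
    (hZ0 : ∀ᵐ ω ∂μ, 0 ≤ varZ F X ω)
    (hZi : ∀ i, ∀ᵐ ω ∂μ, varZi G X i ω ≤ varZ F X ω)
    (W : Ω → ℝ) (hW : Measurable W) (hW0 : ∀ᵐ ω ∂μ, 0 ≤ W ω)
    (hV : ∀ᵐ ω ∂μ, varV F G X ω ≤ W ω * varZ F X ω) :
    (∀ q : ℝ, 2 ≤ q → ∀ θ : ℝ, 0 < θ → θ ≤ 1 →
      eLpNorm (varZ F X) (ENNReal.ofReal q) μ ≤
        ENNReal.ofReal (1 + θ) * extMean μ (varZ F X) +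
          ENNReal.ofReal (kappaConst / 2 * (1 + 1 / θ) * q) *
            eLpNorm W (ENNReal.ofReal q) μ) ∧
    (∀ q : ℝ, 2 ≤ q →
      eLpNorm (devPos μ (varZ F X)) (ENNReal.ofReal q) μ ≤
        (ENNReal.ofReal (2 * kappaConst * q) * eLpNorm W (ENNReal.ofReal q) μ *
            extMean μ (varZ F X)) ^ (1 / 2 : ℝ) +
          ENNReal.ofReal (kappaConst * q) * eLpNorm W (ENNReal.ofReal q) μ) ∧
    cTwo < 2.42 ∧
    (∀ M : Ω → ℝ, Measurable M → (∀ᵐ ω ∂μ, 0 ≤ M ω) →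
      (∀ i, ∀ᵐ ω ∂μ, 0 ≤ varZ F X ω - varZi G X i ω ∧
        varZ F X ω - varZi G X i ω ≤ M ω) →
      ∀ q : ℝ, 2 ≤ q →
        eLpNorm (devNeg μ (varZ F X)) (ENNReal.ofReal q) μ ≤
          (ENNReal.ofReal (cTwo * q) *
            max
              (eLpNorm W (ENNReal.ofReal q) μ *
                (2 * extMean μ (varZ F X) +
                  ENNReal.ofReal (2 * q) * eLpNorm W (ENNReal.ofReal q) μ))
              (ENNReal.ofReal q * eLpNorm M (ENNReal.ofReal q) μ ^ 2)) ^ (1 / 2 : ℝ)) := by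
  have hZm := measurable_varZ hX hF
  let FN : ℕ → (Fin n → 𝒳) → ℝ := fun N x => truncate N (F x)
  let GN : ℕ → (i : Fin n) → ({j : Fin n // j ≠ i} → 𝒳) → ℝ := fun N i x => truncate N (G i x)
  have hFN : ∀ N, Measurable (FN N) := fun N => (measurable_truncate N).comp hF
  have hGN : ∀ N i, Measurable (GN N i) := fun N i => (measurable_truncate N).comp (hG i)
  have hFNB : ∀ (N : ℕ) x, FN N x ∈ Set.Icc (0 : ℝ) N := fun N x => truncate_mem_Icc N _
  have hGNB : ∀ (N : ℕ) i x, GN N i x ∈ Set.Icc (0 : ℝ) N := fun N i x => truncate_mem_Icc N _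
  have hZNm : ∀ N, Measurable (varZ (FN N) X) := fun N => measurable_varZ hX (hFN N)
  have hZiN : ∀ N i, ∀ᵐ ω ∂μ, varZi (GN N) X i ω ≤ varZ (FN N) X ω := by
    intro N i
    filter_upwards [hZi i] with ω hω using truncate_mono N hω
  have hVN : ∀ N, ∀ᵐ ω ∂μ, varV (FN N) (GN N) X ω ≤ W ω * varZ (FN N) X ω := by
    intro N
    filter_upwards [hZ0, ae_all_iff.2 hZi, hV] with ω h0 h1 h2
    exact sum_truncate_sub_sq_le h0 h1 h2
  have hmean : ∀ N, extMean μ (varZ (FN N) X) ≤ extMean μ (varZ F X) :=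
    fun N => extMean_truncate_le hZ0 N
  have hmeanlim : Filter.Tendsto (fun N => extMean μ (varZ (FN N) X)) Filter.atTop
      (nhds (extMean μ (varZ F X))) := tendsto_extMean_truncate hZm hZ0
  refine ⟨?_, ?_, cTwo_lt, ?_⟩
  · intro q hq θ hθ hθ1
    rw [← eLpNorm_ofReal_comp hZ0]
    refine eLpNorm_le_of_tendsto (f := fun N ω => ENNReal.ofReal (varZ (FN N) X ω))
      (by linarith) (fun N => (hZNm N).ennreal_ofReal) ?_ fun N => ?_
    · filter_upwards [hZ0] with ω hω using tendsto_ofReal_truncate hω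
    · have h0 : ∀ ω, 0 ≤ varZ (FN N) X ω := fun ω => (hFNB N _).1
      rw [eLpNorm_ofReal_comp (Filter.Eventually.of_forall h0)]
      refine (eLpNorm_varZ_le_of_bounded hθ hθ1 hq hX hindep (hFN N) (hGN N) (hFNB N) (hGNB N)
        (hZiN N) hW (hVN N)).trans ?_
      gcongr
      exact hmean N
  · intro q hq
    refine eLpNorm_le_of_tendsto (f := fun N => devPos μ (varZ (FN N) X))
      (by linarith) (fun N => (hZNm N).ennreal_ofReal.sub measurable_const) ?_ fun N => ?_
    · filter_upwards [hZ0] with ω hω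
      -- Subtraction is discontinuous only at `∞ - ∞`; `Z` is finite pointwise even when `E Z = ∞`.
      exact ENNReal.Tendsto.sub (tendsto_ofReal_truncate hω) hmeanlim
        (Or.inl ENNReal.ofReal_ne_top)
    · refine (eLpNorm_devPos_le_of_bounded hq hX hindep (hFN N) (hGN N) (hFNB N) (hGNB N)
        (hZiN N) hW (hVN N)).trans ?_
      gcongr
      exact hmean N
  · intro M hM hM0 hZM q hq
    refine eLpNorm_le_of_tendsto (f := fun N => devNeg μ (varZ (FN N) X))
      (by linarith) (fun N => measurable_const.sub (hZNm N).ennreal_ofReal) ?_ fun N => ?_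
    · filter_upwards [hZ0] with ω hω
      exact ENNReal.Tendsto.sub hmeanlim (tendsto_ofReal_truncate hω)
        (Or.inr ENNReal.ofReal_ne_top)
    -- The bounded case needs a bounded `M`; truncating it is harmless since the truncated
    -- differences never exceed `N`.
    · have hMN : ∀ i, ∀ᵐ ω ∂μ, varZ (FN N) X ω - varZi (GN N) X i ω ≤ truncate N (M ω) := by
        intro i
        filter_upwards [hZi i, hZM i] with ω h1 h2
        refine le_max_of_le_right (le_min ((truncate_sub_le h1).trans h2.2) ?_)
        linarith [(hFNB N fun j => X j ω).2, (hGNB N i fun j => X j.1 ω).1,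
          show varZ (FN N) X ω ≤ N from (hFNB N _).2,
          show 0 ≤ varZi (GN N) X i ω from (hGNB N i _).1]
      refine (eLpNorm_devNeg_le_of_bounded hq hX hindep (hFN N) (hGN N) (hFNB N) (hGNB N)
        (hZiN N) hW (hVN N) ((measurable_truncate N).comp hM)
        (fun ω => truncate_mem_Icc N _) hMN).trans ?_
      have hMle : eLpNorm (truncate N ∘ M) (ENNReal.ofReal q) μ
          ≤ eLpNorm M (ENNReal.ofReal q) μ := by
        refine eLpNorm_mono_ae ?_
        filter_upwards [hM0] with ω hω
        rw [Function.comp_apply, Real.norm_of_nonneg hω,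
          Real.norm_of_nonneg (truncate_mem_Icc N _).1]
        exact truncate_le hω
      gcongr
      exact hmean N
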